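/- Consider real-valued functions $\rho\in C^2((0,\infty))$ solving \[ \Delta_1\rho+(1-\rho^2)\rho=0 \ \text{ on } (0,\infty),\qquad \rho(r)\to 1 \ \text{ as } r\to\infty,\qquad \text{where } \Delta_1=\partial_{rr}+\tfrac1r\partial_r-\tfrac1{r^2}. \] This boundary value problem has exactly one solution $\rho_0$ (no condition is imposed at $r=0$). Moreover: (i) $\rho_0$ extends to a $C^1$ function on $[0,\infty)$, $\rho_0'(r)\to0$ and $\rho_0''(r)\to 0$ as $r\to\infty$, and $\rho_0$ is positive and strictly increasing on $(0,\infty)$; (ii) $\rho_0(r)=O(r)$ as $r\to0^+$; (iii) as $r\to\infty$, $1-\rho_0(r)=O(1/r^2)$ and $1-\rho_0(r)^2=\dfrac{1}{r^2}+o\!\left(\dfrac1{r^2}\right)$; (iv) for every $\gamma\in(0,1)$, the function $x\mapsto 1-\rho_0(|x|)^2$ belongs to $H^3_{r,\gamma}(\mathbb R^2)$. Here $H^s_\gamma(\mathbb R^2)$ is the completion of $C_c^\infty(\mathbb R^2,\mathbb C)$ in the norm $\sum_{|\alpha|\le s}\|\,(1+|x|^2)^{\gamma/2}D^\alpha u\|_{L^2(\mathbb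 R^2)}$, and $H^s_{r,\gamma}(\mathbb R^2)$ is its subspace of radially symmetric functions. -/

import Mathlib

open Set Filter Topology MeasureTheory Asymptotics
open scoped ContDiff ENNReal

noncomputable section

/-- `ρ` (only its values on `(0, ∞)` matter) is a classical solution of
`ρ'' + ρ'/r - ρ/r² + (1 - ρ²) ρ = 0` on `(0, ∞)` with `ρ(r) → 1` as `r → ∞`.
No condition is imposed at `r = 0`. -/
structure IsVortexProfile (ρ : ℝ → ℝ) : Prop where
  contDiffOn : ContDiffOn ℝ 2 ρ (Ioi 0)
  ode : ∀ r : ℝ, 0 < r →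
    deriv (deriv ρ) r + (1 / r) * deriv ρ r - (1 / r ^ 2) * ρ r + (1 - ρ r ^ 2) * ρ r = 0
  tendsto_one : Tendsto ρ atTop (𝓝 1)

/-- The Euclidean plane. -/
abbrev Plane : Type := EuclideanSpace ℝ (Fin 2)

/-- The classical partial derivative `∂ᵢ f` of a function on the plane. -/
def partialDeriv (i : Fin 2) (f : Plane → ℂ) : Plane → ℂ :=
  fun x => fderiv ℝ f x (EuclideanSpace.single i 1)

/-- `D^α f = ∂₀^{α₀} ∂₁^{α₁} f` for a multi-index `α = (α₀, α₁)`. -/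
def multiDeriv (α : ℕ × ℕ) (f : Plane → ℂ) : Plane → ℂ :=
  (partialDeriv 0)^[α.1] ((partialDeriv 1)^[α.2] f)

/-- The weight `⟨x⟩^γ = (1 + |x|²)^{γ/2}`. -/
def japaneseWeight (γ : ℝ) (x : Plane) : ℝ := (1 + ‖x‖ ^ 2) ^ (γ / 2)

/-- The weighted `L²` norm `‖ f ⟨x⟩^γ ‖_{L²(ℝ²)}`, with values in `[0, ∞]`. -/
def weightedL2Norm (γ : ℝ) (f : Plane → ℂ) : ℝ≥0∞ :=
  eLpNorm (fun x => (japaneseWeight γ x : ℂ) * f x) 2 volume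

/-- The norm `∑_{|α| ≤ s} ‖ D^α f ⟨x⟩^γ ‖_{L²(ℝ²)}` (used for smooth `f`). -/
def weightedSobolevNorm (s : ℕ) (γ : ℝ) (f : Plane → ℂ) : ℝ≥0∞ :=
  ∑ k ∈ Finset.range (s + 1), ∑ α ∈ Finset.HasAntidiagonal.antidiagonal k, weightedL2Norm γ (multiDeriv α f)

/-- Smooth compactly supported complex-valued functions on the plane. -/
def IsTestFunction (φ : Plane → ℂ) : Prop := ContDiff ℝ ∞ φ ∧ HasCompactSupport φ

/-- Membership in `H^s_γ(ℝ²)`, the completion of `C_c^∞(ℝ², ℂ)` for `weightedSobolevNorm s γ`.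
The completion is realised as a space of functions: `u` belongs to it when it is the limit in the
weighted `L²` norm of a sequence of test functions that is Cauchy for the Sobolev norm. -/
def MemWeightedSobolev (s : ℕ) (γ : ℝ) (u : Plane → ℂ) : Prop :=
  AEStronglyMeasurable u volume ∧
  ∃ φ : ℕ → Plane → ℂ, (∀ n, IsTestFunction (φ n)) ∧
    Tendsto (fun p : ℕ × ℕ => weightedSobolevNorm s γ (φ p.1 - φ p.2)) atTop (𝓝 0) ∧
    Tendsto (fun n => weightedL2Norm γ (φ n - u)) atTop (𝓝 0)

/-- `H^s_{r,γ}(ℝ²)`: the radially symmetric elements of `H^s_γ(ℝ²)`. -/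
def radialWeightedSobolev (s : ℕ) (γ : ℝ) : Set (Plane → ℂ) :=
  {u | MemWeightedSobolev s γ u ∧ ∀ x y : Plane, ‖x‖ = ‖y‖ → u x = u y}

end

/-! Write `ρ(r) = r h(r²)`, `ρ'(r) = p(r²)` and `y = r²`. The vortex equation becomes `y h'' + 2 h'
+ h/4 - y h³/4 = 0`, equivalently a first order system for `(h, p)` on `y > 0`, and every part of
the theorem is read off from `h`.

Regularity at the origin needs no boundary condition: the cubic term absorbs any singularity. A
Keller–Osserman comparison of `(y h)²` with an explicit function blowing up at `y = ε` gives, as `ε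
→ 0`, a bound on `ρ² = y h²` near `0`. Then `(y h)''` is `O(y^{-1/2})`, so `h` has a limit at `0`,
and `h'` solves an Euler equation whose nonsingular solution inherits the smoothness of its
right-hand side; bootstrapping makes `h` smooth in `y` up to `0`.

Uniqueness compares an arbitrary solution with one positive nondecreasing solution through their
quotient `k`. With `κ = k'/h`, the energy `2κ² - (1 - k²)²/4` is nonincreasing, is at most `0`
because `κ → 0` at the origin, and is at least `0` because `k → 1` at infinity. So it vanishes
identically, `κ = 0`, and `k = 1`.

Existence is monotone iteration. After a linear shift the equation is a fixed point problem for an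
order preserving integral operator; `(y + 1)^{-1/2}` is a supersolution and `(y + 4)^{-1/2}` a
subsolution. The iterates decrease to a solution between them, which already gives `0 < 1 - ρ² ≤
4/r²`.

Monotonicity of `ρ` follows from the second derivative test at a local maximum followed by a local
minimum. For the sharp constant, `(y + c)^{-1/2}` is a subsolution near infinity for every `c > 1`;
comparison up to an `O(y^{-2})` error and `c → 1` give `1 - ρ² ~ 1/r²`.

Finally `1 - ρ²` is a smooth function of `|x|²` whose derivatives up to order three in the plane are
`O(⟨x⟩⁻²)`. Since `⟨x⟩^{γ-2}` is square integrable in the plane for `γ < 1`, dilated cutoffs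
approximate it in the weighted Sobolev norm. -/

/-! ### Maximum principle and Euler equations on the half-line -/

theorem IsLocalMax.second_deriv_nonpos {f f' : ℝ → ℝ} {x c : ℝ} (h : IsLocalMax f x)
    (hf : ∀ᶠ y in 𝓝 x, HasDerivAt f (f' y) y) (hf' : HasDerivAt f' c x) : c ≤ 0 := by
  by_contra hc
  push Not at hc
  have e : deriv f =ᶠ[𝓝 x] f' := hf.mono fun y hy => hy.deriv
  have e2 : deriv (deriv f) x = c := by rw [e.deriv_eq, hf'.deriv]
  -- If `c > 0` the point is also a local minimum, so `f` is locally constant and `c = 0`.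
  have hmin : IsLocalMin f x := isLocalMin_of_deriv_deriv_pos (by rw [e2]; exact hc)
    h.deriv_eq_zero hf.self_of_nhds.continuousAt
  have hconst : f =ᶠ[𝓝 x] fun _ => f x := by
    filter_upwards [h, hmin] with y h1 h2 using le_antisymm h1 h2
  have e3 : deriv f =ᶠ[𝓝 x] fun _ => 0 := by
    filter_upwards [hconst.eventuallyEq_nhds] with y hy
    rw [hy.deriv_eq]; simp
  rw [e3.deriv_eq] at e2
  simp at e2
  exact absurd e2 hc.ne

/-- A function that is strictly convex at its positive critical points and nonpositive at the
end points of an interval is nonpositive on the interval. -/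
theorem nonpos_of_second_deriv_pos {f f' f'' : ℝ → ℝ} {p q : ℝ} (hc : ContinuousOn f (Icc p q))
    (h1 : ∀ y ∈ Ioo p q, HasDerivAt f (f' y) y) (h2 : ∀ y ∈ Ioo p q, HasDerivAt f' (f'' y) y)
    (hp : f p ≤ 0) (hq : f q ≤ 0) (hpos : ∀ y ∈ Ioo p q, 0 < f y → f' y = 0 → 0 < f'' y) :
    ∀ y ∈ Icc p q, f y ≤ 0 := by
  intro y hy
  by_contra hfy
  push Not at hfy
  obtain ⟨z, hz, hmax⟩ := isCompact_Icc.exists_isMaxOn ⟨y, hy⟩ hc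
  have hz0 : 0 < f z := hfy.trans_le (hmax hy)
  have hzI : z ∈ Ioo p q :=
    ⟨lt_of_le_of_ne hz.1 fun h => absurd (h ▸ hp) (not_le.2 hz0),
      lt_of_le_of_ne hz.2 fun h => absurd (h ▸ hq) (not_le.2 hz0)⟩
  have hloc : IsLocalMax f z := hmax.isLocalMax (Icc_mem_nhds hzI.1 hzI.2)
  have := hloc.second_deriv_nonpos (eventually_of_mem (Ioo_mem_nhds hzI.1 hzI.2) fun w hw => h1 w hw) (h2 z hzI)
  linarith [hpos z hzI hz0 (hloc.hasDerivAt_eq_zero (h1 z hzI))]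

/-- The solution of `x f' + m f = g` that is not singular at the origin inherits the regularity
of `g` up to the origin. -/
theorem contDiffOn_Ici_of_euler_ode (k : ℕ) : ∀ (m : ℕ) (f g : ℝ → ℝ), 0 < m →
    ContDiffOn ℝ k g (Ici 0) → (∀ x, 0 < x → HasDerivAt f ((g x - m * f x) / x) x) →
    Tendsto (fun x => x ^ m * f x) (𝓝[>] 0) (𝓝 0) → f 0 = g 0 / m →
    ContDiffOn ℝ k f (Ici 0) := by
  have base : ∀ (m : ℕ) (f g : ℝ → ℝ), 0 < m →
      ContinuousOn g (Ici 0) → (∀ x, 0 < x → HasDerivAt f ((g x - m * f x) / x) x) →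
      Tendsto (fun x => x ^ m * f x) (𝓝[>] 0) (𝓝 0) → f 0 = g 0 / m →
      ContinuousOn f (Ici 0) := by
    intro m f g hm hg hf h0 hf0
    have hm' : (m : ℝ) ≠ 0 := by positivity
    -- The equation says `(x ^ m f)' = x ^ (m - 1) g`; L'Hôpital against `x ^ m` gives the limit `g
    -- 0 / m`.
    have hlim : Tendsto (fun x => (x ^ m * f x) / x ^ m) (𝓝[>] 0) (𝓝 (g 0 / m)) := by
      refine HasDerivAt.lhopital_zero_nhdsGT (f' := fun x => x ^ (m - 1) * g x)
        (g' := fun x => m * x ^ (m - 1)) ?_ ?_ ?_ h0 ?_ ?_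
      · filter_upwards [self_mem_nhdsWithin] with x hx
        have hx : 0 < x := hx
        refine ((hasDerivAt_pow m x).mul (hf x hx)).congr_deriv ?_
        obtain ⟨n, rfl⟩ := Nat.exists_eq_succ_of_ne_zero hm.ne'
        simp only [Nat.succ_eq_add_one, Nat.add_sub_cancel]
        field_simp
        ring
      · filter_upwards [self_mem_nhdsWithin] with x hx using hasDerivAt_pow m x
      · filter_upwards [self_mem_nhdsWithin] with x hx
        have hx : 0 < x := hx
        positivity
      · have : Tendsto (fun x : ℝ => x ^ m) (𝓝 0) (𝓝 (0 ^ m)) := (continuous_pow m).tendsto 0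
        rw [zero_pow hm.ne'] at this
        exact this.mono_left nhdsWithin_le_nhds
      · have : Tendsto (fun x => g x / m) (𝓝[>] 0) (𝓝 (g 0 / m)) :=
          ((hg 0 self_mem_Ici).mono_left (nhdsWithin_mono _ Ioi_subset_Ici_self)).div_const _
        refine this.congr' ?_
        filter_upwards [self_mem_nhdsWithin] with x hx
        have hx : 0 < x := hx
        field_simp
    have hlim' : Tendsto f (𝓝[>] 0) (𝓝 (f 0)) := by
      rw [hf0]
      refine hlim.congr' ?_
      filter_upwards [self_mem_nhdsWithin] with x hx
      have hx : 0 < x := hx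
      field_simp
    intro x hx
    rcases (mem_Ici.1 hx).eq_or_lt with rfl | hx
    · rw [← continuousWithinAt_Ioi_iff_Ici]; exact hlim'
    · exact (hf x hx).continuousAt.continuousWithinAt
  induction k with
  | zero =>
    intro m f g hm hg hf h0 hf0
    simp only [Nat.cast_zero, contDiffOn_zero] at hg ⊢
    exact base m f g hm hg hf h0 hf0
  | succ k ih =>
    intro m f g hm hg hf h0 hf0
    have hfc := base m f g hm hg.continuousOn hf h0 hf0
    have hg1 : ContDiffOn ℝ ((k : WithTop ℕ∞) + 1) g (Ici 0) := by exact_mod_cast hg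
    have hg' := ((contDiffOn_succ_iff_derivWithin (uniqueDiffOn_Ici (0 : ℝ))).1 hg1).2.2
    have hgd : ∀ x, 0 < x → HasDerivAt g (derivWithin g (Ici 0) x) x := fun x hx =>
      ((hg.differentiableOn (by simp) x hx.le).hasDerivWithinAt).hasDerivAt (Ici_mem_nhds hx)
    -- Differentiating the equation, `f₁ = f'` solves one of the same type with `m + 1` and `g'`, so
    -- its value at `0` has to be `g' 0 / (m + 1)`.
    set f₁ : ℝ → ℝ := fun x => if x = 0 then derivWithin g (Ici 0) 0 / (m + 1 : ℕ)
      else (g x - m * f x) / x with hf₁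
    have hf₁x : ∀ x, 0 < x → f₁ x = (g x - m * f x) / x := fun x hx => by simp [hf₁, hx.ne']
    have hf₁d : ∀ x, 0 < x →
        HasDerivAt f₁ ((derivWithin g (Ici 0) x - (m + 1 : ℕ) * f₁ x) / x) x := by
      intro x hx
      have h := ((hgd x hx).sub ((hf x hx).const_mul (m : ℝ))).div (hasDerivAt_id x) hx.ne'
      refine (h.congr_of_eventuallyEq (f₁ := f₁) ?_).congr_deriv ?_
      · filter_upwards [lt_mem_nhds hx] with z hz using by simpa using hf₁x z hz
      · rw [hf₁x x hx]
        simp only [Pi.sub_apply, id]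
        push_cast
        field_simp
        ring
    have hC := ih (m + 1) f₁ _ (Nat.succ_pos m) hg' hf₁d (by
      have : Tendsto (fun x => x ^ m * g x - m * (x ^ m * f x)) (𝓝[>] 0) (𝓝 0) := by
        have h1 : Tendsto g (𝓝[>] 0) (𝓝 (g 0)) :=
          (hg.continuousOn 0 self_mem_Ici).mono_left (nhdsWithin_mono _ Ioi_subset_Ici_self)
        have h2 : Tendsto (fun x : ℝ => x ^ m) (𝓝[>] 0) (𝓝 0) := by
          have : Tendsto (fun x : ℝ => x ^ m) (𝓝 0) (𝓝 (0 ^ m)) := (continuous_pow m).tendsto 0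
          rw [zero_pow hm.ne'] at this
          exact this.mono_left nhdsWithin_le_nhds
        simpa using (h2.mul h1).sub (h0.const_mul (m : ℝ))
      refine this.congr' ?_
      filter_upwards [self_mem_nhdsWithin] with x hx
      have hx : 0 < x := hx
      rw [hf₁x x hx]
      field_simp
      ring) (by simp [hf₁])
    have hder : ∀ x ∈ Ici (0 : ℝ), HasDerivWithinAt f (f₁ x) (Ici 0) x := by
      intro x hx
      rcases (mem_Ici.1 hx).eq_or_lt with rfl | hx
      · refine hasDerivWithinAt_Ici_of_tendsto_deriv (s := Ioi 0)
          (fun z hz => (hf z hz).differentiableAt.differentiableWithinAt)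
          ((hfc 0 self_mem_Ici).mono Ioi_subset_Ici_self) self_mem_nhdsWithin ?_
        have : Tendsto f₁ (𝓝[>] 0) (𝓝 (f₁ 0)) :=
          (hC.continuousOn 0 self_mem_Ici).mono_left (nhdsWithin_mono _ Ioi_subset_Ici_self)
        refine this.congr' ?_
        filter_upwards [self_mem_nhdsWithin] with z hz
        rw [(hf z hz).deriv, hf₁x z hz]
      · rw [hf₁x x hx]; exact (hf x hx).hasDerivWithinAt
    have : ContDiffOn ℝ ((k : WithTop ℕ∞) + 1) f (Ici 0) := by
      rw [contDiffOn_succ_iff_derivWithin (uniqueDiffOn_Ici (0 : ℝ))]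
      refine ⟨fun x hx => (hder x hx).differentiableWithinAt, by simp, hC.congr fun x hx => ?_⟩
      exact (hder x hx).derivWithin (uniqueDiffOn_Ici (0 : ℝ) x hx)
    exact_mod_cast this

/-! ### The system in the variable `y = r²` and regularity at the origin -/

/-- The vortex equation for `ρ(r) = r h(r²)`, `ρ'(r) = p(r²)` as a first order system. -/
structure IsRadialProfile (h p : ℝ → ℝ) : Prop where
  hasDerivAt_fst : ∀ y, 0 < y → HasDerivAt h ((p y - h y) / (2 * y)) y
  hasDerivAt_snd : ∀ y, 0 < y →
    HasDerivAt p ((h y - p y) / (2 * y) - (1 - y * h y ^ 2) * h y / 2) y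

namespace IsRadialProfile

variable {h p : ℝ → ℝ}

theorem hasDerivAt_mul (H : IsRadialProfile h p) {y : ℝ} (hy : 0 < y) :
    HasDerivAt (fun y => y * h y) ((h y + p y) / 2) y := by
  refine ((hasDerivAt_id y).mul (H.hasDerivAt_fst y hy)).congr_deriv ?_
  simp only [id]
  field_simp
  ring

theorem hasDerivAt_add (H : IsRadialProfile h p) {y : ℝ} (hy : 0 < y) :
    HasDerivAt (fun y => (h y + p y) / 2) (-((1 - y * h y ^ 2) * h y / 4)) y := by
  refine (((H.hasDerivAt_fst y hy).add (H.hasDerivAt_snd y hy)).div_const 2).congr_deriv ?_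
  field_simp
  ring

/-- The barrier blows up at `y = ε`, while for fixed `y` its logarithmic terms vanish as `ε → 0`. -/
theorem hasDerivAt_log_barrier {M ε y : ℝ} (hε : 0 < ε) (hy : ε < y) :
    HasDerivAt (fun y => M * y + 12 * ((Real.log (y / ε))⁻¹ + ((Real.log (y / ε))⁻¹) ^ 2))
      (M - 12 * ((Real.log (y / ε))⁻¹ ^ 2 + 2 * (Real.log (y / ε))⁻¹ ^ 3) / y) y ∧
    HasDerivAt (fun y => M - 12 * ((Real.log (y / ε))⁻¹ ^ 2 + 2 * (Real.log (y / ε))⁻¹ ^ 3) / y)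
      (12 * ((Real.log (y / ε))⁻¹ ^ 2 + 4 * (Real.log (y / ε))⁻¹ ^ 3
        + 6 * (Real.log (y / ε))⁻¹ ^ 4) / y ^ 2) y := by
  have hy0 : 0 < y := hε.trans hy
  have hl : 0 < Real.log (y / ε) := Real.log_pos ((one_lt_div hε).2 hy)
  have hu : HasDerivAt (fun y => (Real.log (y / ε))⁻¹) (-((Real.log (y / ε))⁻¹ ^ 2) / y) y := by
    have h1 : HasDerivAt (fun y => y / ε) (1 / ε) y := (hasDerivAt_id y).div_const ε
    refine ((h1.log (by positivity)).inv hl.ne').congr_deriv ?_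
    field_simp
  constructor
  · refine (((hasDerivAt_id y).const_mul M).add ((hu.add (hu.pow 2)).const_mul 12)).congr_deriv ?_
    simp only [Nat.cast_ofNat, Nat.add_one_sub_one, pow_one]
    ring
  · refine (((((hu.pow 2).add ((hu.pow 3).const_mul 2)).const_mul 12).div (hasDerivAt_id y)
      hy0.ne').const_sub M).congr_deriv ?_
    simp only [Nat.cast_ofNat, id, Nat.add_one_sub_one, pow_one, Pi.pow_apply, Pi.add_apply]
    field_simp
    ring

/-- With `X = y h²`, the second derivative of `(y h)²` is at least `X (X - 1) / 2`. Wherever `(y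
h)²` exceeds the barrier this beats the barrier's own second derivative, so the maximum principle
excludes a positive interior maximum of the difference. -/
theorem sq_mul_le_log_barrier (H : IsRadialProfile h p) {M ε y : ℝ} (hM : 1 ≤ M)
    (hM' : h 1 ^ 2 ≤ M) (hε : 0 < ε) (hy : ε < y) (hy1 : y ≤ 1) :
    (y * h y) ^ 2 ≤ M * y + 12 * ((Real.log (y / ε))⁻¹ + ((Real.log (y / ε))⁻¹) ^ 2) := by
  have hcont : ContinuousOn (fun y => (y * h y) ^ 2) (Ioi 0) := fun z hz =>
    ((H.hasDerivAt_mul hz).continuousAt.pow 2).continuousWithinAt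
  have hlp : ∀ z, ε < z → 0 < Real.log (z / ε) := fun z hz =>
    Real.log_pos ((one_lt_div hε).2 hz)
  obtain ⟨Q, hQ⟩ := (isCompact_Icc (a := ε) (b := 1)).exists_bound_of_continuousOn
    (hcont.mono fun z hz => hε.trans_le hz.1)
  have hQ0 : 0 ≤ Q := (norm_nonneg _).trans (hQ y ⟨hy.le, hy1⟩)
  -- The left end point `z₁` has `log (z₁ / ε) = l`; the first bound on `l` makes the barrier there
  -- exceed `Q ≥ (y h)²`, the second keeps `z₁ ≤ y`.
  set l := min (12 / (Q + 1)) (Real.log (y / ε)) with hldef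
  have hl : 0 < l := lt_min (by positivity) (hlp y hy)
  set z₁ := ε * Real.exp l with hz₁
  have hz₁ε : ε < z₁ := by
    rw [hz₁]; exact lt_mul_of_one_lt_right hε (Real.one_lt_exp_iff.2 hl)
  have hlog : Real.log (z₁ / ε) = l := by
    rw [hz₁, mul_div_assoc, mul_comm, div_mul_cancel₀ _ hε.ne', Real.log_exp]
  have hz₁y : z₁ ≤ y := by
    have : Real.exp l ≤ y / ε := by
      rw [← Real.le_log_iff_exp_le (by have := hε.trans hy; positivity)]
      exact min_le_right _ _
    rw [hz₁]
    calc ε * Real.exp l ≤ ε * (y / ε) := by gcongr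
      _ = y := by field_simp
  have key := nonpos_of_second_deriv_pos (p := z₁) (q := 1)
    (f := fun y => (y * h y) ^ 2
      - (M * y + 12 * ((Real.log (y / ε))⁻¹ + ((Real.log (y / ε))⁻¹) ^ 2)))
    (f' := fun y => 2 * (y * h y) * ((h y + p y) / 2)
      - (M - 12 * ((Real.log (y / ε))⁻¹ ^ 2 + 2 * (Real.log (y / ε))⁻¹ ^ 3) / y))
    (f'' := fun y => (2 * ((h y + p y) / 2) ^ 2 + 2 * (y * h y) * (-((1 - y * h y ^ 2) * h y / 4)))
      - 12 * ((Real.log (y / ε))⁻¹ ^ 2 + 4 * (Real.log (y / ε))⁻¹ ^ 3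
        + 6 * (Real.log (y / ε))⁻¹ ^ 4) / y ^ 2) ?_ ?_ ?_ ?_ ?_ ?_ y ⟨hz₁y, hy1⟩
  · simpa using key
  · intro z hz
    have hz' := hz₁ε.trans_le hz.1
    exact (((H.hasDerivAt_mul (hε.trans hz')).pow 2).sub
      (hasDerivAt_log_barrier hε hz').1).continuousAt.continuousWithinAt
  · intro z hz
    have hz' := hz₁ε.trans hz.1
    refine (((H.hasDerivAt_mul (hε.trans hz')).pow 2).sub
      (hasDerivAt_log_barrier hε hz').1).congr_deriv ?_
    simp
  · intro z hz
    have hz' := hz₁ε.trans hz.1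
    refine ((((H.hasDerivAt_mul (hε.trans hz')).const_mul 2).mul
      (H.hasDerivAt_add (hε.trans hz'))).sub
      (hasDerivAt_log_barrier hε hz').2).congr_deriv ?_
    ring
  · have h1 : (z₁ * h z₁) ^ 2 ≤ Q :=
      (le_abs_self _).trans (hQ z₁ ⟨hz₁ε.le, hz₁y.trans hy1⟩)
    have h2 : Q + 1 ≤ 12 * l⁻¹ := by
      have : l ≤ 12 / (Q + 1) := min_le_left _ _
      rw [le_div_iff₀ (by positivity)] at this
      rw [← div_eq_mul_inv, le_div_iff₀ hl]
      linarith
    have h3 : 0 ≤ M * z₁ := by have := hε.trans hz₁ε; positivity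
    simp only [hlog]
    nlinarith [sq_nonneg l⁻¹]
  · have h1 := hlp 1 (hy.trans_le hy1)
    have h2 : 0 < (Real.log (1 / ε))⁻¹ := inv_pos.2 h1
    simp only [one_mul, mul_one]
    nlinarith
  · intro z hz hpos _
    have hz' := hz₁ε.trans hz.1
    have hz0 := hε.trans hz'
    have hu : 0 < (Real.log (z / ε))⁻¹ := inv_pos.2 (hlp z hz')
    set u := (Real.log (z / ε))⁻¹
    set X := z * h z ^ 2 with hX
    have hq : (z * h z) ^ 2 = z * X := by rw [hX]; ring
    rw [hq] at hpos
    have hY : M + 12 * (u + u ^ 2) / z < X := by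
      rw [← sub_pos]
      have : X - (M + 12 * (u + u ^ 2) / z) = (z * X - (M * z + 12 * (u + u ^ 2))) / z := by
        field_simp
      rw [this]; positivity
    set v := 12 * (u + u ^ 2) / z with hv
    have hv0 : 0 < v := by positivity
    have hXX : v ^ 2 < X * (X - 1) := by nlinarith
    have e1 : 2 * (z * h z) * (-((1 - X) * h z / 4)) = X * (X - 1) / 2 := by
      rw [hX]; ring
    have e2 : 12 * (u ^ 2 + 4 * u ^ 3 + 6 * u ^ 4) / z ^ 2 ≤ v ^ 2 / 2 := by
      rw [hv, div_pow, div_div, div_le_div_iff₀ (by positivity) (by positivity)]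
      -- The constant 12 comes from here: the `u ^ 4` coefficients on the two sides are equal.
      have : 12 * (u ^ 2 + 4 * u ^ 3 + 6 * u ^ 4) * 2 ≤ (12 * (u + u ^ 2)) ^ 2 := by
        nlinarith [pow_pos hu 2, pow_pos hu 3, pow_pos hu 4]
      nlinarith [pow_pos hz0 2]
    rw [e1]
    nlinarith [sq_nonneg ((h z + p z) / 2)]

theorem exists_mul_sq_le (H : IsRadialProfile h p) :
    ∃ M, 1 ≤ M ∧ ∀ y, 0 < y → y ≤ 1 → y * h y ^ 2 ≤ M := by
  refine ⟨max 1 (h 1 ^ 2), le_max_left _ _, fun y hy hy1 => ?_⟩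
  set M := max 1 (h 1 ^ 2)
  have hl : Tendsto (fun ε => (Real.log (y / ε))⁻¹) (𝓝[>] 0) (𝓝 0) := by
    refine tendsto_inv_atTop_zero.comp (Real.tendsto_log_atTop.comp ?_)
    exact (tendsto_inv_nhdsGT_zero.const_mul_atTop hy).congr fun ε => (div_eq_mul_inv y ε).symm
  have hlim : Tendsto (fun ε => M * y + 12 * ((Real.log (y / ε))⁻¹ + ((Real.log (y / ε))⁻¹) ^ 2))
      (𝓝[>] 0) (𝓝 (M * y)) := by
    simpa using ((hl.add (hl.pow 2)).const_mul 12).const_add (M * y)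
  have hle : (y * h y) ^ 2 ≤ M * y := by
    refine ge_of_tendsto hlim ?_
    filter_upwards [Ioo_mem_nhdsGT hy] with ε hε
    exact H.sq_mul_le_log_barrier (le_max_left _ _) (le_max_right _ _) hε.1 hε.2 hy1
  have : y * (y * h y ^ 2) ≤ y * M := by nlinarith
  exact le_of_mul_le_mul_left this hy

/-- Solutions of the vortex equation have no singularity at the origin. -/
theorem exists_tendsto_zero (H : IsRadialProfile h p) :
    ∃ l, Tendsto h (𝓝[>] 0) (𝓝 l) ∧ Tendsto (fun y => (h y + p y) / 2) (𝓝[>] 0) (𝓝 l) := by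
  obtain ⟨M, hM, hb⟩ := H.exists_mul_sq_le
  have hmem : Ioo (0 : ℝ) 1 ∈ 𝓝[>] (0 : ℝ) := Ioo_mem_nhdsGT one_pos
  -- The left side is the size of `(y h)''`. Its `y^{-1/2}` bound is integrable, so adding or
  -- subtracting the primitive `2 M² √y` makes `(y h)'` monotone and forces a limit.
  have hg : ∀ y ∈ Ioo (0 : ℝ) 1, |(1 - y * h y ^ 2) * h y / 4| ≤ M ^ 2 / √y := by
    intro y hy
    have hs : 0 < √y := Real.sqrt_pos.2 hy.1
    have h1 := hb y hy.1 hy.2.le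
    have h0 : 0 ≤ y * h y ^ 2 := mul_nonneg hy.1.le (sq_nonneg _)
    have h2 : |h y| * √y ≤ M := by
      refine abs_le_of_sq_le_sq' ?_ (by linarith) |>.2
      rw [mul_pow, sq_abs, Real.sq_sqrt hy.1.le]
      nlinarith
    rw [le_div_iff₀ hs, abs_div, abs_mul, abs_of_pos (by norm_num : (0 : ℝ) < 4)]
    have h3 : |1 - y * h y ^ 2| ≤ M := abs_le.2 ⟨by linarith, by linarith⟩
    have : |1 - y * h y ^ 2| * (|h y| * √y) ≤ M * M := by gcongr
    have h4 : 0 ≤ |1 - y * h y ^ 2| * (|h y| * √y) := by positivity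
    nlinarith
  have hsq : ∀ y ∈ Ioo (0 : ℝ) 1, HasDerivAt (fun y => 2 * M ^ 2 * √y) (M ^ 2 / √y) y := by
    intro y hy
    refine ((Real.hasDerivAt_sqrt hy.1.ne').const_mul (2 * M ^ 2)).congr_deriv ?_
    field_simp
  have hmono : MonotoneOn (fun y => (h y + p y) / 2 + 2 * M ^ 2 * √y) (Ioo 0 1) := by
    have hd : ∀ y ∈ Ioo (0 : ℝ) 1, HasDerivAt (fun y => (h y + p y) / 2 + 2 * M ^ 2 * √y)
      (-((1 - y * h y ^ 2) * h y / 4) + M ^ 2 / √y) y := fun y hy =>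
      (H.hasDerivAt_add hy.1).add (hsq y hy)
    refine monotoneOn_of_hasDerivWithinAt_nonneg (convex_Ioo 0 1)
      (fun y hy => (hd y hy).continuousAt.continuousWithinAt)
      (fun y hy => (hd y (interior_subset hy)).hasDerivWithinAt) fun y hy => ?_
    linarith [(abs_le.1 (hg y (interior_subset hy))).2]
  have hanti : AntitoneOn (fun y => (h y + p y) / 2 - 2 * M ^ 2 * √y) (Ioo 0 1) := by
    have hd : ∀ y ∈ Ioo (0 : ℝ) 1, HasDerivAt (fun y => (h y + p y) / 2 - 2 * M ^ 2 * √y)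
      (-((1 - y * h y ^ 2) * h y / 4) - M ^ 2 / √y) y := fun y hy =>
      (H.hasDerivAt_add hy.1).sub (hsq y hy)
    refine antitoneOn_of_hasDerivWithinAt_nonpos (convex_Ioo 0 1)
      (fun y hy => (hd y hy).continuousAt.continuousWithinAt)
      (fun y hy => (hd y (interior_subset hy)).hasDerivWithinAt) fun y hy => ?_
    linarith [(abs_le.1 (hg y (interior_subset hy))).1]
  have hs0 : Tendsto (fun y => 2 * M ^ 2 * √y) (𝓝[>] 0) (𝓝 0) := by
    have : Tendsto (fun y => 2 * M ^ 2 * √y) (𝓝 0) (𝓝 (2 * M ^ 2 * √0)) :=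
      (continuous_const.mul Real.continuous_sqrt).tendsto 0
    simp only [Real.sqrt_zero, mul_zero] at this
    exact this.mono_left nhdsWithin_le_nhds
  obtain ⟨l, hl⟩ : ∃ l, Tendsto (fun y => (h y + p y) / 2) (𝓝[>] 0) (𝓝 l) := by
    have hbdd : BddBelow ((fun y => (h y + p y) / 2 + 2 * M ^ 2 * √y) '' Ioo 0 1) := by
      refine ⟨(h (1 / 2) + p (1 / 2)) / 2 - 2 * M ^ 2 * √(1 / 2), ?_⟩
      rintro _ ⟨y, hy, rfl⟩
      have hs : 0 ≤ 2 * M ^ 2 * √y := by positivity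
      have hs' : 0 ≤ 2 * M ^ 2 * √(1 / 2) := by positivity
      rcases le_total y (1 / 2) with hy2 | hy2
      · have := hanti hy (by norm_num : (1 / 2 : ℝ) ∈ Ioo (0 : ℝ) 1) hy2
        simp only at this ⊢
        linarith
      · have := hmono (by norm_num : (1 / 2 : ℝ) ∈ Ioo (0 : ℝ) 1) hy hy2
        simp only at this ⊢
        linarith
    have := hmono.tendsto_nhdsWithin_Ioo_right (x := 0) (by simp) hbdd
    exact ⟨_, by simpa only [add_sub_cancel_right] using this.sub hs0⟩
  refine ⟨l, ?_, hl⟩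
  have ha0 : Tendsto (fun y => y * h y) (𝓝[>] 0) (𝓝 0) := by
    have h1 : Tendsto (fun y => M * √y) (𝓝[>] 0) (𝓝 0) := by
      have : Tendsto (fun y => M * √y) (𝓝 0) (𝓝 (M * √0)) :=
        (continuous_const.mul Real.continuous_sqrt).tendsto 0
      simp only [Real.sqrt_zero, mul_zero] at this
      exact this.mono_left nhdsWithin_le_nhds
    refine squeeze_zero_norm' ?_ h1
    filter_upwards [hmem] with y hy
    rw [Real.norm_eq_abs]
    refine abs_le_of_sq_le_sq ?_ (by positivity)
    rw [mul_pow, mul_pow, Real.sq_sqrt hy.1.le]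
    have := hb y hy.1 hy.2.le
    nlinarith [hy.1, mul_nonneg hy.1.le (sub_nonneg.2 hM), mul_le_mul_of_nonneg_left this hy.1.le]
  -- `h` is the quotient of `y h` by `y`, both tending to `0`, so it has the same limit as `(y h)'`.
  have := HasDerivAt.lhopital_zero_nhdsGT (f := fun y => y * h y) (g := fun y => y)
    (f' := fun y => (h y + p y) / 2) (g' := fun _ => 1) (l := 𝓝 l)
    (by filter_upwards [self_mem_nhdsWithin] with y hy using H.hasDerivAt_mul hy)
    (by filter_upwards with y using hasDerivAt_id y) (by simp) ha0
    (tendsto_id.mono_left nhdsWithin_le_nhds) (by simpa using hl)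
  refine this.congr' ?_
  filter_upwards [self_mem_nhdsWithin] with y hy
  have hy : 0 < y := hy
  field_simp

/-- Solutions of the vortex equation are smooth functions of `r²` up to the origin. -/
theorem exists_contDiffOn_extension (H : IsRadialProfile h p) :
    ∃ g : ℝ → ℝ, EqOn g h (Ioi 0) ∧ ContDiffOn ℝ ∞ g (Ici 0) ∧
      Tendsto h (𝓝[>] 0) (𝓝 (g 0)) ∧
      Tendsto (fun y => (p y - h y) / (2 * y)) (𝓝[>] 0) (𝓝 (-(g 0) / 8)) := by
  obtain ⟨l, hl, hl'⟩ := H.exists_tendsto_zero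
  set g : ℝ → ℝ := Function.update h 0 l with hg
  have hg0 : g 0 = l := by simp [hg]
  have hgy : ∀ y, 0 < y → g y = h y := fun y hy => by simp [hg, hy.ne']
  -- `D = h'` solves `y D' + 2 D = -(1 - y h²) h / 4`; setting `y = 0` dictates the value `-l / 8`.
  -- As the right side is polynomial in `y` and `h`, regularity `C^k` of `h` passes to `D`, hence
  -- `C^(k+1)` to `h`.
  set D : ℝ → ℝ := Function.update (fun y => (p y - h y) / (2 * y)) 0 (-l / 8) with hD
  have hD0 : D 0 = -l / 8 := by simp [hD]
  have hDy : ∀ y, 0 < y → D y = (p y - h y) / (2 * y) := fun y hy => by simp [hD, hy.ne']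
  have hgd : ∀ y, 0 < y → HasDerivAt g (D y) y := fun y hy => by
    rw [hDy y hy]
    refine (H.hasDerivAt_fst y hy).congr_of_eventuallyEq ?_
    filter_upwards [lt_mem_nhds hy] with z hz using hgy z hz
  have hgc : ContinuousOn g (Ici 0) := by
    intro y hy
    rcases (mem_Ici.1 hy).eq_or_lt with rfl | hy
    · rw [← continuousWithinAt_Ioi_iff_Ici, ContinuousWithinAt, hg0]
      exact hl.congr' (by filter_upwards [self_mem_nhdsWithin] with z hz using (hgy z hz).symm)
    · exact (hgd y hy).continuousAt.continuousWithinAt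
  have hDd : ∀ y, 0 < y →
      HasDerivAt D ((-((1 - y * g y ^ 2) * g y / 4) - (2 : ℕ) * D y) / y) y := fun y hy => by
    have h1 := (((H.hasDerivAt_snd y hy).sub (H.hasDerivAt_fst y hy)).div
      ((hasDerivAt_id y).const_mul 2) (by simp [hy.ne'])).congr_of_eventuallyEq (f₁ := D)
      (by filter_upwards [lt_mem_nhds hy] with z hz using by simp [hDy z hz])
    refine h1.congr_deriv ?_
    rw [hDy y hy, hgy y hy]
    simp only [id, Pi.sub_apply]
    push_cast
    field_simp
    ring
  have hDlim : Tendsto (fun y => y ^ 2 * D y) (𝓝[>] 0) (𝓝 0) := by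
    have h0 : Tendsto (fun y : ℝ => y) (𝓝[>] 0) (𝓝 0) := tendsto_id.mono_left nhdsWithin_le_nhds
    have : Tendsto (fun y => y * ((h y + p y) / 2 - h y)) (𝓝[>] 0) (𝓝 0) := by
      simpa using h0.mul (hl'.sub hl)
    refine this.congr' ?_
    filter_upwards [self_mem_nhdsWithin] with y hy
    have hy : 0 < y := hy
    rw [hDy y hy]
    field_simp
    ring
  have hstep : ∀ k : ℕ, ContDiffOn ℝ k g (Ici 0) → ContDiffOn ℝ k D (Ici 0) := fun k hk =>
    contDiffOn_Ici_of_euler_ode k 2 D (fun y => -((1 - y * g y ^ 2) * g y / 4)) two_pos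
      ((((contDiffOn_const.sub (contDiffOn_id.mul (hk.pow 2))).mul hk).div_const 4).neg) hDd hDlim
      (by rw [hD0, hg0]; simp only [zero_mul]; push_cast; ring)
  have hDc : Tendsto D (𝓝[>] 0) (𝓝 (D 0)) :=
    ((hstep 0 (contDiffOn_zero.2 hgc)).continuousOn 0 self_mem_Ici).mono_left
      (nhdsWithin_mono _ Ioi_subset_Ici_self)
  have hder : ∀ y ∈ Ici (0 : ℝ), HasDerivWithinAt g (D y) (Ici 0) y := by
    intro y hy
    rcases (mem_Ici.1 hy).eq_or_lt with rfl | hy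
    · refine hasDerivWithinAt_Ici_of_tendsto_deriv (s := Ioi 0)
        (fun z hz => (hgd z hz).differentiableAt.differentiableWithinAt)
        ((hgc 0 self_mem_Ici).mono Ioi_subset_Ici_self) self_mem_nhdsWithin ?_
      refine hDc.congr' ?_
      filter_upwards [self_mem_nhdsWithin] with z hz using (hgd z hz).deriv.symm
    · exact (hgd y hy).hasDerivWithinAt
  have hsmooth : ∀ k : ℕ, ContDiffOn ℝ k g (Ici 0) := by
    intro k
    induction k with
    | zero => exact contDiffOn_zero.2 hgc
    | succ k ih =>
      have : ContDiffOn ℝ ((k : WithTop ℕ∞) + 1) g (Ici 0) := by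
        rw [contDiffOn_succ_iff_derivWithin (uniqueDiffOn_Ici (0 : ℝ))]
        refine ⟨fun x hx => (hder x hx).differentiableWithinAt, by simp,
          (hstep k ih).congr fun x hx => ?_⟩
        exact (hder x hx).derivWithin (uniqueDiffOn_Ici (0 : ℝ) x hx)
      exact_mod_cast this
  refine ⟨g, hgy, contDiffOn_infty.2 hsmooth, by rwa [hg0], ?_⟩
  rw [hg0, ← hD0]
  exact hDc.congr' (by filter_upwards [self_mem_nhdsWithin] with z hz using hDy z hz)

end IsRadialProfile

/-! ### Uniqueness by a Lyapunov function -/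

namespace IsRadialProfile

variable {h p s q : ℝ → ℝ}

/-- The derivative of the quotient of two solutions. -/
theorem hasDerivAt_div (H : IsRadialProfile h p) (S : IsRadialProfile s q)
    {y : ℝ} (hy : 0 < y) (hh : h y ≠ 0) :
    HasDerivAt (fun y => s y / h y) ((q y * h y - s y * p y) / (2 * y * h y ^ 2)) y := by
  refine ((S.hasDerivAt_fst y hy).div (H.hasDerivAt_fst y hy) hh).congr_deriv ?_
  field_simp
  ring

/-- The differentiated quantity is `κ = k' / h` with `k = s / h`. The extra factor `1 / h` makes the
zeroth order term `h² k (k² - 1) / 4` equal to `h` times a function of `k` times `k'/κ`, so that it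
integrates to a potential in `k` alone. -/
theorem hasDerivAt_wronskian (H : IsRadialProfile h p) (S : IsRadialProfile s q)
    {y : ℝ} (hy : 0 < y) (hh : h y ≠ 0) :
    HasDerivAt (fun y => (q y * h y - s y * p y) / (2 * y * h y ^ 3))
      (s y * (s y ^ 2 - h y ^ 2) / (4 * h y ^ 2)
        - ((q y * h y - s y * p y) / (2 * y * h y ^ 3)) / (2 * y) * (1 + 3 * p y / h y)) y := by
  have h1 := ((S.hasDerivAt_snd y hy).mul (H.hasDerivAt_fst y hy)).sub
    ((S.hasDerivAt_fst y hy).mul (H.hasDerivAt_snd y hy))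
  have h2 := ((hasDerivAt_id y).const_mul 2).mul ((H.hasDerivAt_fst y hy).pow 3)
  refine (h1.div h2 (by simp [hy.ne', hh])).congr_deriv ?_
  simp only [id, Pi.mul_apply, Pi.sub_apply, Pi.pow_apply, Nat.cast_ofNat, Nat.add_one_sub_one,
    mul_one]
  field_simp
  ring

/-- The quantity `2 κ² - (1 - k²)² / 4` with `k` the quotient of two solutions and `κ` its weighted
derivative is a Lyapunov function. -/
theorem hasDerivAt_energy (H : IsRadialProfile h p) (S : IsRadialProfile s q)
    {y : ℝ} (hy : 0 < y) (hh : h y ≠ 0) :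
    HasDerivAt (fun y => 2 * ((q y * h y - s y * p y) / (2 * y * h y ^ 3)) ^ 2
        - (1 - (s y / h y) ^ 2) ^ 2 / 4)
      (-(2 * ((q y * h y - s y * p y) / (2 * y * h y ^ 3)) ^ 2 / y * (1 + 3 * p y / h y))) y := by
  refine ((((H.hasDerivAt_wronskian S hy hh).pow 2).const_mul 2).sub
    (((((H.hasDerivAt_div S hy hh).pow 2).const_sub 1).pow 2).div_const 4)).congr_deriv ?_
  simp only [Pi.pow_apply, Nat.cast_ofNat, Nat.add_one_sub_one, pow_one]
  field_simp
  ring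

/-- A solution is determined by its limit `1` at infinity once there is one positive
nondecreasing solution with this limit. -/
theorem eqOn_of_tendsto_div (H : IsRadialProfile h p) (S : IsRadialProfile s q)
    (hpos : ∀ y, 0 < y → 0 < h y) (hp : ∀ y, 0 < y → 0 ≤ p y) {l : ℝ} (hl : 0 < l)
    (hl0 : Tendsto h (𝓝[>] 0) (𝓝 l)) (hlim : Tendsto (fun y => s y / h y) atTop (𝓝 1)) :
    EqOn s h (Ioi 0) := by
  obtain ⟨g, hgh, hgC, hg0, hg1⟩ := H.exists_contDiffOn_extension
  obtain ⟨f, hfs, hfC, hf0, hf1⟩ := S.exists_contDiffOn_extension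
  have hgl : g 0 = l := tendsto_nhds_unique hg0 hl0
  have hg00 : g 0 ≠ 0 := by rw [hgl]; exact hl.ne'
  set κ : ℝ → ℝ := fun y => (q y * h y - s y * p y) / (2 * y * h y ^ 3) with hκ
  set G : ℝ → ℝ := fun y => 2 * κ y ^ 2 - (1 - (s y / h y) ^ 2) ^ 2 / 4 with hG
  have hGd : ∀ y, 0 < y → HasDerivAt G (-(2 * κ y ^ 2 / y * (1 + 3 * p y / h y))) y :=
    fun y hy => H.hasDerivAt_energy S hy (hpos y hy).ne'
  have hanti : AntitoneOn G (Ioi 0) := by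
    refine antitoneOn_of_hasDerivWithinAt_nonpos (convex_Ioi 0)
      (fun y hy => (hGd y hy).continuousAt.continuousWithinAt)
      (fun y hy => (hGd y (interior_subset hy)).hasDerivWithinAt) fun y hy => ?_
    have hy : 0 < y := interior_subset hy
    have h1 := hpos y hy
    have h2 := hp y hy
    have : 0 ≤ 2 * κ y ^ 2 / y * (1 + 3 * p y / h y) := by positivity
    linarith
  -- Both solutions satisfy `h'(0) = -h(0)/8`, so the Wronskian-type numerator cancels in the limit.
  have hκ0 : Tendsto κ (𝓝[>] 0) (𝓝 0) := by
    have : Tendsto (fun y => ((q y - s y) / (2 * y) * h y - s y * ((p y - h y) / (2 * y)))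
        / h y ^ 3) (𝓝[>] 0) (𝓝 ((-f 0 / 8 * g 0 - f 0 * (-g 0 / 8)) / g 0 ^ 3)) :=
      ((hf1.mul hg0).sub (hf0.mul hg1)).div (hg0.pow 3) (pow_ne_zero 3 hg00)
    rw [show (-f 0 / 8 * g 0 - f 0 * (-g 0 / 8)) / g 0 ^ 3 = 0 by ring] at this
    refine this.congr' ?_
    filter_upwards [self_mem_nhdsWithin] with y hy
    have hy : 0 < y := hy
    have := hpos y hy
    simp only [hκ]
    field_simp
    ring
  have hGle : ∀ y, 0 < y → G y ≤ 0 := by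
    intro y hy
    have h2 : Tendsto (fun y => 2 * κ y ^ 2) (𝓝[>] 0) (𝓝 0) := by
      simpa using (hκ0.pow 2).const_mul 2
    refine ge_of_tendsto h2 ?_
    filter_upwards [Ioo_mem_nhdsGT hy] with z hz
    refine (hanti hz.1 hy hz.2.le).trans ?_
    simp only [hG]
    nlinarith [sq_nonneg (1 - (s z / h z) ^ 2)]
  have hGge : ∀ y, 0 < y → 0 ≤ G y := by
    intro y hy
    have h2 : Tendsto (fun y => -((1 - (s y / h y) ^ 2) ^ 2 / 4)) atTop (𝓝 0) := by
      simpa using ((((hlim.pow 2).const_sub 1).pow 2).div_const 4).neg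
    refine le_of_tendsto h2 ?_
    filter_upwards [eventually_ge_atTop y] with z hz
    refine le_trans ?_ (hanti hy (hy.trans_le hz) hz)
    simp only [hG]
    nlinarith [sq_nonneg (κ z)]
  -- `G` is squeezed to `0`, so its derivative, a strictly negative multiple of `κ²`, vanishes.
  have hκz : ∀ y, 0 < y → κ y = 0 := by
    intro y hy
    have h0 : HasDerivAt G 0 y := (hasDerivAt_const y (0 : ℝ)).congr_of_eventuallyEq
      (by filter_upwards [lt_mem_nhds hy] with z hz using le_antisymm (hGle z hz) (hGge z hz))
    have h1 := (hGd y hy).unique h0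
    have h2 := hpos y hy
    have h3 := hp y hy
    have h4 : 0 < 1 + 3 * p y / h y := by positivity
    rw [neg_eq_zero, mul_eq_zero, or_iff_left h4.ne'] at h1
    simpa [hy.ne'] using h1
  have hconst : ∀ y, 0 < y → ∀ z, 0 < z → s y / h y = s z / h z := by
    have hd : ∀ y ∈ Ioi (0 : ℝ), HasDerivWithinAt (fun y => s y / h y) 0 (Ioi 0) y := by
      intro y hy
      have hy : 0 < y := hy
      refine ((H.hasDerivAt_div S hy (hpos y hy).ne').congr_deriv ?_).hasDerivWithinAt
      have h1 := hpos y hy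
      have : (q y * h y - s y * p y) / (2 * y * h y ^ 2) = κ y * h y := by
        simp only [hκ]; field_simp
      rw [this, hκz y hy, zero_mul]
    intro y hy z hz
    exact (convex_Ioi (0 : ℝ)).is_const_of_fderivWithin_eq_zero (𝕜 := ℝ)
      (fun w hw => (hd w hw).differentiableWithinAt)
      (fun w hw => by
        rw [← toSpanSingleton_derivWithin, (hd w hw).derivWithin (uniqueDiffOn_Ioi 0 w hw)]
        simp) hy hz
  intro y hy
  have hy : 0 < y := hy
  have h1 : s y / h y = 1 := by
    refine tendsto_nhds_unique (tendsto_const_nhds.congr' ?_) hlim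
    filter_upwards [eventually_gt_atTop 0] with z hz using hconst y hy z hz
  rwa [div_eq_one_iff_eq (hpos y hy).ne'] at h1

end IsRadialProfile

/-! ### The integral equation and its comparison principle -/

/-- The nonlinearity of the vortex equation, shifted so as to be monotone. -/
noncomputable def vortexSource (s u : ℝ) : ℝ := (s / 16 + 3 / 4) * u - s * u ^ 3 / 4

/-- Since `e^{y/4}` solves `y φ'' + 2 φ' = (y/16 + 1/2) φ`, the quantity `Ψ = y² e^{y/4} (h' - h/4)
= y² e^{y/2} (e^{-y/4} h)'` turns the vortex equation into `Ψ' = -y e^{y/4} vortexSource y h`.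
Integrating from `0` gives `Ψ = -vortexInner h`; integrating `(e^{-y/4} h)'` from infinity gives the
fixed point equation. -/
noncomputable def vortexInner (h : ℝ → ℝ) (t : ℝ) : ℝ :=
  ∫ s in (0 : ℝ)..t, s * Real.exp (s / 4) * vortexSource s (h s)

noncomputable def vortexKernel (h : ℝ → ℝ) (t : ℝ) : ℝ :=
  (t ^ 2)⁻¹ * Real.exp (-(t / 2)) * vortexInner h t

/-- The integral operator whose fixed points solve the vortex equation. -/
noncomputable def vortexOperator (h : ℝ → ℝ) (y : ℝ) : ℝ :=
  Real.exp (y / 4) * ∫ t in Ioi y, vortexKernel h t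

/-- The class on which the source is nonnegative and increasing in `h`, and on which the integrals
converge. -/
structure VortexAdmissible (h : ℝ → ℝ) : Prop where
  meas : AEStronglyMeasurable h (volume.restrict (Ioi 0))
  nonneg : ∀ y, 0 < y → 0 ≤ h y
  le_one : ∀ y, 0 < y → h y ≤ 1
  mul_sq_le : ∀ y, 0 < y → y * h y ^ 2 ≤ 1

theorem vortexSource_nonneg {s u : ℝ} (hs : 0 < s) (hu : 0 ≤ u) (hu2 : s * u ^ 2 ≤ 1) :
    0 ≤ vortexSource s u := by
  have : vortexSource s u = u * (s / 16 + 3 / 4 - s * u ^ 2 / 4) := by rw [vortexSource]; ring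
  rw [this]
  exact mul_nonneg hu (by linarith)

theorem vortexSource_le {s u : ℝ} (hs : 0 < s) (hu : 0 ≤ u) (hu1 : u ≤ 1) :
    vortexSource s u ≤ s / 16 + 3 / 4 := by
  have h1 : 0 ≤ s * u ^ 3 / 4 := by positivity
  have h2 : (s / 16 + 3 / 4) * u ≤ (s / 16 + 3 / 4) * 1 := by gcongr
  rw [vortexSource]
  linarith

/-- The bound `s v² ≤ 1` limits the loss from the cubic term to `3/4`, exactly what the shift
supplies. -/
theorem vortexSource_mono {s u v : ℝ} (hs : 0 < s) (hu : 0 ≤ u) (huv : u ≤ v)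
    (hv : s * v ^ 2 ≤ 1) : vortexSource s u ≤ vortexSource s v := by
  have h1 : s * (u ^ 2 + u * v + v ^ 2) ≤ 3 := by
    have : u ^ 2 + u * v + v ^ 2 ≤ 3 * v ^ 2 := by nlinarith
    nlinarith
  have : vortexSource s v - vortexSource s u
      = (v - u) * (s / 16 + 3 / 4 - s * (u ^ 2 + u * v + v ^ 2) / 4) := by
    simp only [vortexSource]; ring
  have := mul_nonneg (sub_nonneg.2 huv)
    (by linarith : 0 ≤ s / 16 + 3 / 4 - s * (u ^ 2 + u * v + v ^ 2) / 4)
  linarith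

namespace VortexAdmissible

variable {h g : ℝ → ℝ}

theorem source_nonneg (A : VortexAdmissible h) {s : ℝ} (hs : 0 < s) :
    0 ≤ s * Real.exp (s / 4) * vortexSource s (h s) :=
  mul_nonneg (by positivity) (vortexSource_nonneg hs (A.nonneg s hs) (A.mul_sq_le s hs))

theorem source_le (A : VortexAdmissible h) {s t : ℝ} (hs : 0 < s) (hst : s ≤ t) :
    s * Real.exp (s / 4) * vortexSource s (h s) ≤ t * Real.exp (t / 4) * (t / 16 + 3 / 4) := by
  have h1 := vortexSource_le hs (A.nonneg s hs) (A.le_one s hs)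
  have h2 := vortexSource_nonneg hs (A.nonneg s hs) (A.mul_sq_le s hs)
  have h3 : 0 < t := hs.trans_le hst
  calc s * Real.exp (s / 4) * vortexSource s (h s)
      ≤ s * Real.exp (s / 4) * (s / 16 + 3 / 4) := by gcongr
    _ ≤ _ := by gcongr

theorem source_meas (A : VortexAdmissible h) :
    AEStronglyMeasurable (fun s => s * Real.exp (s / 4) * vortexSource s (h s))
      (volume.restrict (Ioi 0)) := by
  have := A.meas.aemeasurable
  unfold vortexSource
  exact AEMeasurable.aestronglyMeasurable (by fun_prop)

theorem source_intervalIntegrable (A : VortexAdmissible h) {t : ℝ} (ht : 0 ≤ t) :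
    IntervalIntegrable (fun s => s * Real.exp (s / 4) * vortexSource s (h s)) volume 0 t := by
  rw [intervalIntegrable_iff_integrableOn_Ioc_of_le ht]
  refine Integrable.mono' (g := fun _ => t * Real.exp (t / 4) * (t / 16 + 3 / 4))
    (integrableOn_const (by simp)) (A.source_meas.mono_measure
      (Measure.restrict_mono (fun s (hs : s ∈ Ioc 0 t) => hs.1) le_rfl)) ?_
  filter_upwards [ae_restrict_mem measurableSet_Ioc] with s hs
  rw [Real.norm_of_nonneg (A.source_nonneg hs.1)]
  exact A.source_le hs.1 hs.2

theorem inner_nonneg (A : VortexAdmissible h) {t : ℝ} (ht : 0 ≤ t) : 0 ≤ vortexInner h t := by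
  rw [vortexInner, intervalIntegral.integral_of_le ht]
  exact setIntegral_nonneg measurableSet_Ioc fun s hs => A.source_nonneg hs.1

theorem inner_le (A : VortexAdmissible h) {t : ℝ} (ht : 0 ≤ t) :
    vortexInner h t ≤ t ^ 2 * Real.exp (t / 4) * (t / 16 + 3 / 4) := by
  have := intervalIntegral.norm_integral_le_of_norm_le_const (a := 0) (b := t)
    (f := fun s => s * Real.exp (s / 4) * vortexSource s (h s))
    (C := t * Real.exp (t / 4) * (t / 16 + 3 / 4)) (fun s hs => by
      rw [uIoc_of_le ht] at hs
      rw [Real.norm_of_nonneg (A.source_nonneg hs.1)]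
      exact A.source_le hs.1 hs.2)
  refine (le_abs_self _).trans (this.trans_eq ?_)
  rw [sub_zero, abs_of_nonneg ht]
  ring

theorem inner_mono (A : VortexAdmissible h) (B : VortexAdmissible g)
    (hgh : ∀ y, 0 < y → h y ≤ g y) {t : ℝ} (ht : 0 ≤ t) : vortexInner h t ≤ vortexInner g t := by
  rw [vortexInner, vortexInner]
  refine intervalIntegral.integral_mono_on_of_le_Ioo ht (A.source_intervalIntegrable ht)
    (B.source_intervalIntegrable ht) fun s hs => ?_
  have hs0 : 0 < s := hs.1
  have := vortexSource_mono hs0 (A.nonneg s hs0) (hgh s hs0) (B.mul_sq_le s hs0)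
  gcongr

theorem inner_continuousOn (A : VortexAdmissible h) : ContinuousOn (vortexInner h) (Ici 0) := by
  intro t ht
  have h0 : (0 : ℝ) ≤ t + 1 := by have := mem_Ici.1 ht; linarith
  have := intervalIntegral.continuousOn_primitive_interval'
    (A.source_intervalIntegrable h0) left_mem_uIcc
  rw [uIcc_of_le h0] at this
  refine (this t ⟨ht, by linarith⟩).mono_of_mem_nhdsWithin ?_
  rw [← Ici_inter_Iic]
  exact inter_mem_nhdsWithin _ (Iic_mem_nhds (by linarith))

theorem inner_tendsto_zero (A : VortexAdmissible h) :
    Tendsto (vortexInner h) (𝓝[>] 0) (𝓝 0) := by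
  have := (A.inner_continuousOn 0 self_mem_Ici).mono_left (nhdsWithin_mono _ Ioi_subset_Ici_self)
  simpa [vortexInner] using this

theorem inner_hasDerivAt (A : VortexAdmissible h) (hc : ContinuousOn h (Ioi 0)) {t : ℝ}
    (ht : 0 < t) :
    HasDerivAt (vortexInner h) (t * Real.exp (t / 4) * vortexSource t (h t)) t := by
  have hcont : ContinuousOn (fun s => s * Real.exp (s / 4) * vortexSource s (h s)) (Ioi 0) := by
    unfold vortexSource
    fun_prop
  exact intervalIntegral.integral_hasDerivAt_right (A.source_intervalIntegrable ht.le)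
    (hcont.stronglyMeasurableAtFilter isOpen_Ioi t ht) (hcont.continuousAt (Ioi_mem_nhds ht))

theorem kernel_nonneg (A : VortexAdmissible h) {t : ℝ} (ht : 0 < t) : 0 ≤ vortexKernel h t :=
  mul_nonneg (by positivity) (A.inner_nonneg ht.le)

theorem kernel_le (A : VortexAdmissible h) {t : ℝ} (ht : 0 < t) :
    vortexKernel h t ≤ Real.exp (-(1 / 8) * t) := by
  have h1 := A.inner_le ht.le
  -- The exponents `-1/2 + 1/4 + 1/8 = -1/8` leave a decaying majorant independent of `h`, later
  -- used for dominated convergence.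
  have h2 : t / 16 + 3 / 4 ≤ Real.exp (t / 8) := by
    have := Real.add_one_le_exp (t / 8); linarith
  calc vortexKernel h t
      ≤ (t ^ 2)⁻¹ * Real.exp (-(t / 2)) * (t ^ 2 * Real.exp (t / 4) * Real.exp (t / 8)) := by
        unfold vortexKernel
        gcongr
        exact h1.trans (by gcongr)
    _ = Real.exp (-(t / 2)) * Real.exp (t / 4) * Real.exp (t / 8) := by field_simp
    _ = Real.exp (-(1 / 8) * t) := by rw [← Real.exp_add, ← Real.exp_add]; ring_nf

theorem kernel_continuousOn (A : VortexAdmissible h) :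
    ContinuousOn (vortexKernel h) (Ioi 0) := by
  have h1 := A.inner_continuousOn.mono Ioi_subset_Ici_self
  have h2 : ContinuousOn (fun t : ℝ => (t ^ 2)⁻¹) (Ioi 0) :=
    (continuous_pow 2).continuousOn.inv₀ fun t ht => pow_ne_zero 2 (ne_of_gt ht)
  exact (h2.mul (by fun_prop)).mul h1

theorem kernel_integrableOn (A : VortexAdmissible h) : IntegrableOn (vortexKernel h) (Ioi 0) := by
  refine (exp_neg_integrableOn_Ioi 0 (by norm_num : (0 : ℝ) < 1 / 8)).mono'
    (A.kernel_continuousOn.aestronglyMeasurable measurableSet_Ioi) ?_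
  filter_upwards [ae_restrict_mem measurableSet_Ioi] with t ht
  rw [Real.norm_of_nonneg (A.kernel_nonneg ht)]
  exact A.kernel_le ht

theorem tail_hasDerivAt (A : VortexAdmissible h) {y : ℝ} (hy : 0 < y) :
    HasDerivAt (fun y => ∫ t in Ioi y, vortexKernel h t) (-vortexKernel h y) y := by
  have h1 : HasDerivAt (fun y => (∫ t in Ioi 0, vortexKernel h t)
      - ∫ t in (0 : ℝ)..y, vortexKernel h t) (-vortexKernel h y) y := by
    refine (intervalIntegral.integral_hasDerivAt_right ?_
      (A.kernel_continuousOn.stronglyMeasurableAtFilter isOpen_Ioi y hy)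
      (A.kernel_continuousOn.continuousAt (Ioi_mem_nhds hy))).const_sub _
    rw [intervalIntegrable_iff_integrableOn_Ioc_of_le hy.le]
    exact A.kernel_integrableOn.mono_set fun s hs => hs.1
  refine h1.congr_of_eventuallyEq ?_
  filter_upwards [lt_mem_nhds hy] with z hz
  rw [← intervalIntegral.integral_Ioi_sub_Ioi A.kernel_integrableOn hz.le]
  ring

theorem tail_tendsto_zero (A : VortexAdmissible h) :
    Tendsto (fun y => ∫ t in Ioi y, vortexKernel h t) atTop (𝓝 0) := by
  have h1 := (intervalIntegral_tendsto_integral_Ioi 0 A.kernel_integrableOn tendsto_id).const_sub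
    (∫ t in Ioi 0, vortexKernel h t)
  rw [sub_self] at h1
  refine h1.congr' ?_
  filter_upwards [eventually_ge_atTop 0] with z hz
  rw [id, ← intervalIntegral.integral_Ioi_sub_Ioi A.kernel_integrableOn hz]
  ring

theorem operator_continuousOn (A : VortexAdmissible h) :
    ContinuousOn (vortexOperator h) (Ioi 0) := fun y hy =>
  (ContinuousAt.mul (by fun_prop) (A.tail_hasDerivAt hy).continuousAt).continuousWithinAt

theorem operator_mono (A : VortexAdmissible h) (B : VortexAdmissible g)
    (hgh : ∀ y, 0 < y → h y ≤ g y) {y : ℝ} (hy : 0 < y) :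
    vortexOperator h y ≤ vortexOperator g y := by
  refine mul_le_mul_of_nonneg_left ?_ (Real.exp_pos _).le
  refine setIntegral_mono_on (A.kernel_integrableOn.mono_set (Ioi_subset_Ioi hy.le))
    (B.kernel_integrableOn.mono_set (Ioi_subset_Ioi hy.le)) measurableSet_Ioi fun t ht => ?_
  have ht : 0 < t := hy.trans ht
  have := A.inner_mono B hgh ht.le
  unfold vortexKernel
  gcongr

theorem operator_nonneg (A : VortexAdmissible h) {y : ℝ} (hy : 0 < y) :
    0 ≤ vortexOperator h y :=
  mul_nonneg (Real.exp_pos _).le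
    (setIntegral_nonneg measurableSet_Ioi fun _ ht => A.kernel_nonneg (hy.trans ht))

theorem operator_of_le (A : VortexAdmissible h) (B : VortexAdmissible g)
    (hle : ∀ y, 0 < y → vortexOperator h y ≤ g y) : VortexAdmissible (vortexOperator h) where
  meas := A.operator_continuousOn.aestronglyMeasurable measurableSet_Ioi
  nonneg _ hy := A.operator_nonneg hy
  le_one y hy := (hle y hy).trans (B.le_one y hy)
  mul_sq_le y hy := by
    have h1 := hle y hy
    have h2 := A.operator_nonneg hy
    refine le_trans ?_ (B.mul_sq_le y hy)
    gcongr

/-- A sub- or supersolution `u` of the differential equation (according to the sign of `ε`)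
is one of the integral equation. -/
theorem operator_comparison (A : VortexAdmissible h) (hc : ContinuousOn h (Ioi 0))
    {h' R : ℝ → ℝ} {ε : ℝ} (hd : ∀ y, 0 < y → HasDerivAt h (h' y) y)
    (hd2 : ∀ y, 0 < y → HasDerivAt (fun y => y ^ 2 * Real.exp (y / 4) * (h' y - h y / 4))
      (y * Real.exp (y / 4) * (R y - vortexSource y (h y))) y)
    (h0 : Tendsto (fun y => y ^ 2 * Real.exp (y / 4) * (h' y - h y / 4)) (𝓝[>] 0) (𝓝 0))
    (hR : ∀ y, 0 < y → ε * R y ≤ 0) {y : ℝ} (hy : 0 < y) :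
    0 ≤ ε * (h y - vortexOperator h y) := by
  -- `R` is the residual of the differential equation: `Ψ + vortexInner h` has derivative `y e^{y/4}
  -- R` and limit `0` at the origin, so its sign is known. It is in turn, up to a positive factor,
  -- the derivative of `e^{-y/4} h` minus the tail integral, which vanishes at infinity. `ε = 1`
  -- treats supersolutions, `ε = -1` subsolutions.
  set Ψ := fun y => y ^ 2 * Real.exp (y / 4) * (h' y - h y / 4) with hΨ
  have hder : ∀ y, 0 < y → HasDerivAt (fun y => ε * (Ψ y + vortexInner h y))
      (ε * R y * (y * Real.exp (y / 4))) y := fun y hy =>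
    (((hd2 y hy).add (A.inner_hasDerivAt hc hy)).const_mul ε).congr_deriv (by ring)
  have hanti : AntitoneOn (fun y => ε * (Ψ y + vortexInner h y)) (Ioi 0) := by
    refine antitoneOn_of_hasDerivWithinAt_nonpos (convex_Ioi 0)
      (fun y hy => (hder y hy).continuousAt.continuousWithinAt)
      (fun y hy => (hder y (interior_subset hy)).hasDerivWithinAt) fun y hy => ?_
    have hy : 0 < y := interior_subset hy
    exact mul_nonpos_of_nonpos_of_nonneg (hR y hy) (by positivity)
  have hle : ∀ y, 0 < y → ε * (Ψ y + vortexInner h y) ≤ 0 := by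
    intro y hy
    have h2 : Tendsto (fun y => ε * (Ψ y + vortexInner h y)) (𝓝[>] 0) (𝓝 0) := by
      simpa using (h0.add A.inner_tendsto_zero).const_mul ε
    refine ge_of_tendsto h2 ?_
    filter_upwards [Ioo_mem_nhdsGT hy] with z hz using hanti hz.1 hy hz.2.le
  set E := fun y => ε * (Real.exp (-(y / 4)) * h y - ∫ t in Ioi y, vortexKernel h t) with hE
  have hEd : ∀ y, 0 < y → HasDerivAt E
      (ε * (Ψ y + vortexInner h y) * ((y ^ 2)⁻¹ * Real.exp (-(y / 2)))) y := by
    intro y hy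
    have h1 : HasDerivAt (fun y : ℝ => Real.exp (-(y / 4))) (Real.exp (-(y / 4)) * (-(1 / 4))) y :=
      (((hasDerivAt_id y).div_const 4).neg).exp
    refine (((h1.mul (hd y hy)).sub (A.tail_hasDerivAt hy)).const_mul ε).congr_deriv ?_
    have e : Real.exp (-(y / 4)) = Real.exp (y / 4) * Real.exp (-(y / 2)) := by
      rw [← Real.exp_add]; ring_nf
    simp only [hΨ, vortexKernel]
    rw [e]
    field_simp
    ring
  have hEanti : AntitoneOn E (Ioi 0) := by
    refine antitoneOn_of_hasDerivWithinAt_nonpos (convex_Ioi 0)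
      (fun y hy => (hEd y hy).continuousAt.continuousWithinAt)
      (fun y hy => (hEd y (interior_subset hy)).hasDerivWithinAt) fun y hy => ?_
    have hy : 0 < y := interior_subset hy
    exact mul_nonpos_of_nonpos_of_nonneg (hle y hy) (by positivity)
  have hE0 : Tendsto E atTop (𝓝 0) := by
    have h1 : Tendsto (fun y => Real.exp (-(y / 4)) * h y) atTop (𝓝 0) := by
      have h2 : Tendsto (fun y : ℝ => Real.exp (-(y / 4))) atTop (𝓝 0) :=
        Real.tendsto_exp_neg_atTop_nhds_zero.comp (tendsto_id.atTop_div_const four_pos)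
      refine squeeze_zero_norm' ?_ h2
      filter_upwards [eventually_gt_atTop 0] with z hz
      rw [Real.norm_of_nonneg (mul_nonneg (Real.exp_pos _).le (A.nonneg z hz))]
      exact mul_le_of_le_one_right (Real.exp_pos _).le (A.le_one z hz)
    simpa using (h1.sub A.tail_tendsto_zero).const_mul ε
  have hEy : 0 ≤ E y := by
    refine le_of_tendsto hE0 ?_
    filter_upwards [eventually_ge_atTop y] with z hz using hEanti hy (hy.trans_le hz) hz
  have : ε * (h y - vortexOperator h y) = Real.exp (y / 4) * E y := by
    simp only [hE, vortexOperator]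
    have e : Real.exp (y / 4) * Real.exp (-(y / 4)) = 1 := by rw [← Real.exp_add]; simp
    linear_combination (-(ε * h y)) * e
  rw [this]
  exact mul_nonneg (Real.exp_pos _).le hEy

/-- A continuous fixed point of the integral operator solves the vortex equation. -/
theorem exists_isRadialProfile (A : VortexAdmissible h)
    (hfix : ∀ y, 0 < y → vortexOperator h y = h y) : ∃ p, IsRadialProfile h p := by
  have hc : ContinuousOn h (Ioi 0) :=
    A.operator_continuousOn.congr fun y hy => (hfix y hy).symm
  have hexp : ∀ y : ℝ, HasDerivAt (fun y => Real.exp (y / 4)) (Real.exp (y / 4) * (1 / 4)) y :=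
    fun y => ((hasDerivAt_id y).div_const 4).exp
  have hexp' : ∀ y : ℝ, HasDerivAt (fun y => Real.exp (-(y / 4)))
      (Real.exp (-(y / 4)) * (-(1 / 4))) y := fun y => (((hasDerivAt_id y).div_const 4).neg).exp
  have hd : ∀ y, 0 < y → HasDerivAt h
      (h y / 4 - Real.exp (-(y / 4)) * vortexInner h y / y ^ 2) y := by
    intro y hy
    have h1 := ((hexp y).mul (A.tail_hasDerivAt hy)).congr_of_eventuallyEq (f₁ := h) (by
      filter_upwards [lt_mem_nhds hy] with z hz using (hfix z hz).symm)
    refine h1.congr_deriv ?_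
    have e : Real.exp (-(y / 4)) = Real.exp (y / 4) * Real.exp (-(y / 2)) := by
      rw [← Real.exp_add]; ring_nf
    conv_rhs => rw [← hfix y hy]
    simp only [vortexOperator, vortexKernel]
    rw [e]
    field_simp
    ring
  -- The first equation of the system forces `p = h + 2 y h'`; insert the formula for `h'`.
  refine ⟨fun y => h y + y * h y / 2 - 2 * (Real.exp (-(y / 4)) * vortexInner h y) / y,
    fun y hy => (hd y hy).congr_deriv ?_, fun y hy => ?_⟩
  · field_simp
    ring
  · have h1 := ((hd y hy).add (((hasDerivAt_id y).mul (hd y hy)).div_const 2)).sub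
      ((((hexp' y).mul (A.inner_hasDerivAt hc hy)).const_mul 2).div (hasDerivAt_id y) hy.ne')
    refine h1.congr_deriv ?_
    have e : Real.exp (-(y / 4)) = (Real.exp (y / 4))⁻¹ := Real.exp_neg _
    have := Real.exp_pos (y / 4)
    simp only [id, Pi.mul_apply, vortexSource]
    rw [e]
    field_simp
    ring

end VortexAdmissible

/-! ### Barriers and existence by monotone iteration -/

/-- The barrier `(y + c)^{-1/2}`: a subsolution for `c = 4`, a supersolution for `c = 1`. -/
noncomputable def vortexBarrier (c y : ℝ) : ℝ := (√(y + c))⁻¹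

theorem vortexBarrier_pos {c y : ℝ} (hy : 0 < y + c) : 0 < vortexBarrier c y :=
  inv_pos.2 (Real.sqrt_pos.2 hy)

theorem vortexBarrier_sq {c y : ℝ} (hy : 0 < y + c) : vortexBarrier c y ^ 2 = (y + c)⁻¹ := by
  rw [vortexBarrier, inv_pow, Real.sq_sqrt hy.le]

theorem add_mul_vortexBarrier_sq {c y : ℝ} (hy : 0 < y + c) :
    (y + c) * vortexBarrier c y ^ 2 = 1 := by
  rw [vortexBarrier_sq hy, mul_inv_cancel₀ hy.ne']

theorem hasDerivAt_vortexBarrier {c y : ℝ} (hy : 0 < y + c) :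
    HasDerivAt (vortexBarrier c) (-(vortexBarrier c y ^ 3) / 2) y := by
  have hs := Real.sqrt_pos.2 hy
  refine ((((hasDerivAt_id y).add_const c).sqrt hy.ne').inv hs.ne').congr_deriv ?_
  simp only [vortexBarrier, id]
  field_simp

theorem vortexAdmissible_barrier {c : ℝ} (hc : 1 ≤ c) : VortexAdmissible (vortexBarrier c) where
  meas := ContinuousOn.aestronglyMeasurable (fun y hy => (hasDerivAt_vortexBarrier (by
    have := mem_Ioi.1 hy; linarith)).continuousAt.continuousWithinAt) measurableSet_Ioi
  nonneg y hy := (vortexBarrier_pos (by linarith)).le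
  le_one y hy := inv_le_one_of_one_le₀ (Real.one_le_sqrt.2 (by linarith))
  mul_sq_le y hy := by
    have h1 := add_mul_vortexBarrier_sq (c := c) (y := y) (by linarith)
    nlinarith [sq_nonneg (vortexBarrier c y)]

/-- For `u = (y + c)^{-1/2}` the residual is `u³ (c - 1 - 3 c u²) / 4`, thanks to `(y + c) u² = 1`.
-/
theorem vortexOperator_barrier {c ε : ℝ} (hc : 1 ≤ c)
    (hε : ∀ y, 0 < y → ε * (c - 1 - 3 * c * vortexBarrier c y ^ 2) ≤ 0) {y : ℝ} (hy : 0 < y) :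
    0 ≤ ε * (vortexBarrier c y - vortexOperator (vortexBarrier c) y) := by
  have hd : ∀ y, 0 ≤ y →
      HasDerivAt (vortexBarrier c) (-(vortexBarrier c y ^ 3) / 2) y := fun y hy =>
    hasDerivAt_vortexBarrier (by linarith)
  have hexp : ∀ y : ℝ, HasDerivAt (fun y => Real.exp (y / 4)) (Real.exp (y / 4) * (1 / 4)) y :=
    fun y => ((hasDerivAt_id y).div_const 4).exp
  have hd2 : ∀ y, 0 ≤ y → HasDerivAt (fun y => y ^ 2 * Real.exp (y / 4) *
        (-(vortexBarrier c y ^ 3) / 2 - vortexBarrier c y / 4))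
      (y * Real.exp (y / 4) * (vortexBarrier c y ^ 3 / 4 * (c - 1 - 3 * c * vortexBarrier c y ^ 2)
        - vortexSource y (vortexBarrier c y))) y := by
    intro y hy
    refine (((hasDerivAt_pow 2 y).mul (hexp y)).mul
      (((((hd y hy).pow 3).neg).div_const 2).sub ((hd y hy).div_const 4))).congr_deriv ?_
    have e := add_mul_vortexBarrier_sq (c := c) (y := y) (by linarith)
    have e' : c * vortexBarrier c y ^ 2 = 1 - y * vortexBarrier c y ^ 2 := by linarith
    simp only [Pi.mul_apply, Pi.sub_apply, Pi.neg_apply, Pi.pow_apply, vortexSource]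
    push_cast
    set u := vortexBarrier c y
    set w := Real.exp (y / 4)
    linear_combination (-(y * w * u / 4) + 3 / 4 * y * w * u ^ 3) * e'
  refine (vortexAdmissible_barrier hc).operator_comparison
    (fun y hy => (hd y (le_of_lt hy)).continuousAt.continuousWithinAt) (fun y hy => hd y hy.le)
    (fun y hy => hd2 y hy.le) ?_ (fun y hy => ?_) hy
  · have h1 := (hd2 0 le_rfl).continuousAt.tendsto
    simp only [ne_eq, OfNat.ofNat_ne_zero, not_false_eq_true, zero_pow, zero_mul] at h1
    exact h1.mono_left nhdsWithin_le_nhds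
  · have h1 := vortexBarrier_pos (c := c) (y := y) (by linarith)
    have := hε y hy
    have h2 : 0 ≤ vortexBarrier c y ^ 3 / 4 := by positivity
    nlinarith

/-- Existence of a solution of the vortex equation between the two barriers. -/
theorem exists_isRadialProfile : ∃ h p, IsRadialProfile h p ∧
    ∀ y, 0 < y → vortexBarrier 4 y ≤ h y ∧ h y ≤ vortexBarrier 1 y := by
  have hsuper : ∀ y, 0 < y → vortexOperator (vortexBarrier 1) y ≤ vortexBarrier 1 y := by
    intro y hy
    have := vortexOperator_barrier (c := 1) (ε := 1) le_rfl (fun y hy => by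
      nlinarith [sq_nonneg (vortexBarrier 1 y)]) hy
    linarith
  have hsub : ∀ y, 0 < y → vortexBarrier 4 y ≤ vortexOperator (vortexBarrier 4) y := by
    intro y hy
    -- Here `c - 1 - 3 c u² = 3 y / (y + 4)`, which is nonnegative down to `y = 0`; any smaller `c >
    -- 1` fails near `0`.
    have := vortexOperator_barrier (c := 4) (ε := -1) (by norm_num) (fun y hy => by
      have := add_mul_vortexBarrier_sq (c := 4) (y := y) (by linarith)
      nlinarith [sq_nonneg (vortexBarrier 4 y)]) hy
    linarith
  have A1 := vortexAdmissible_barrier (le_refl (1 : ℝ))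
  have A4 := vortexAdmissible_barrier (by norm_num : (1 : ℝ) ≤ 4)
  have h41 : ∀ y, 0 < y → vortexBarrier 4 y ≤ vortexBarrier 1 y := by
    intro y hy
    refine inv_anti₀ (Real.sqrt_pos.2 (by linarith)) (Real.sqrt_le_sqrt (by linarith))
  -- Iterating from the supersolution gives a decreasing sequence bounded below by the subsolution;
  -- dominated convergence in both integrals makes the limit a fixed point.
  set H : ℕ → ℝ → ℝ := fun n => vortexOperator^[n] (vortexBarrier 1) with hH
  have hsucc : ∀ n, H (n + 1) = vortexOperator (H n) := fun n =>
    Function.iterate_succ_apply' _ _ _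
  have hinv : ∀ n, VortexAdmissible (H n) ∧ (∀ y, 0 < y → H (n + 1) y ≤ H n y) ∧
      (∀ y, 0 < y → vortexBarrier 4 y ≤ H n y) ∧ (∀ y, 0 < y → H n y ≤ vortexBarrier 1 y) := by
    intro n
    induction n with
    | zero => exact ⟨A1, hsuper, h41, fun y _ => le_rfl⟩
    | succ n ih =>
      obtain ⟨hA, hle, hlo, hup⟩ := ih
      have hup' : ∀ y, 0 < y → H (n + 1) y ≤ vortexBarrier 1 y := fun y hy =>
        (hle y hy).trans (hup y hy)
      have hA' : VortexAdmissible (H (n + 1)) := by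
        rw [hsucc] at hup' ⊢
        exact hA.operator_of_le A1 hup'
      refine ⟨hA', fun y hy => ?_, fun y hy => ?_, hup'⟩
      · rw [hsucc (n + 1), hsucc n]
        rw [hsucc] at hA' hle
        exact hA'.operator_mono hA hle hy
      · rw [hsucc]
        exact (hsub y hy).trans (A4.operator_mono hA hlo hy)
  have hlim : ∀ y, 0 < y → Tendsto (fun n => H n y) atTop (𝓝 (⨅ n, H n y)) := fun y hy =>
    tendsto_atTop_ciInf (antitone_nat_of_succ_le fun n => (hinv n).2.1 y hy)
      ⟨vortexBarrier 4 y, by rintro _ ⟨n, rfl⟩; exact (hinv n).2.2.1 y hy⟩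
  set h : ℝ → ℝ := fun y => ⨅ n, H n y with hh
  have hlo : ∀ y, 0 < y → vortexBarrier 4 y ≤ h y := fun y hy =>
    ge_of_tendsto' (hlim y hy) fun n => (hinv n).2.2.1 y hy
  have hup : ∀ y, 0 < y → h y ≤ vortexBarrier 1 y := fun y hy =>
    le_of_tendsto' (hlim y hy) fun n => (hinv n).2.2.2 y hy
  have hA : VortexAdmissible h :=
    { meas := aestronglyMeasurable_of_tendsto_ae atTop (fun n => (hinv n).1.meas) (by
        filter_upwards [ae_restrict_mem measurableSet_Ioi] with y hy using hlim y hy)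
      nonneg := fun y hy => ge_of_tendsto' (hlim y hy) fun n => (hinv n).1.nonneg y hy
      le_one := fun y hy => le_of_tendsto' (hlim y hy) fun n => (hinv n).1.le_one y hy
      mul_sq_le := fun y hy => le_of_tendsto' (((hlim y hy).pow 2).const_mul y) fun n =>
        (hinv n).1.mul_sq_le y hy }
  have hJ : ∀ t, 0 < t → Tendsto (fun n => vortexInner (H n) t) atTop (𝓝 (vortexInner h t)) := by
    intro t ht
    refine intervalIntegral.tendsto_integral_filter_of_dominated_convergence
      (fun _ => t * Real.exp (t / 4) * (t / 16 + 3 / 4)) (Eventually.of_forall fun n => ?_)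
      (Eventually.of_forall fun n => Eventually.of_forall fun s hs => ?_) (by simp)
      (Eventually.of_forall fun s hs => ?_)
    · rw [uIoc_of_le ht.le]
      exact (hinv n).1.source_meas.mono_measure
        (Measure.restrict_mono (fun s (hs : s ∈ Ioc 0 t) => hs.1) le_rfl)
    · rw [uIoc_of_le ht.le] at hs
      rw [Real.norm_of_nonneg ((hinv n).1.source_nonneg hs.1)]
      exact (hinv n).1.source_le hs.1 hs.2
    · rw [uIoc_of_le ht.le] at hs
      have := hlim s hs.1
      unfold vortexSource
      exact ((this.const_mul _).sub (((this.pow 3).const_mul s).div_const 4)).const_mul _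
  have hT : ∀ y, 0 < y →
      Tendsto (fun n => vortexOperator (H n) y) atTop (𝓝 (vortexOperator h y)) := by
    intro y hy
    refine Tendsto.const_mul _ ?_
    refine tendsto_integral_of_dominated_convergence (fun t => Real.exp (-(1 / 8) * t))
      (fun n => ?_) (exp_neg_integrableOn_Ioi y (by norm_num : (0 : ℝ) < 1 / 8)) (fun n => ?_) ?_
    · exact ((hinv n).1.kernel_continuousOn.mono (Ioi_subset_Ioi hy.le)).aestronglyMeasurable
        measurableSet_Ioi
    · filter_upwards [ae_restrict_mem measurableSet_Ioi] with t ht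
      have ht : 0 < t := hy.trans ht
      rw [Real.norm_of_nonneg ((hinv n).1.kernel_nonneg ht)]
      exact (hinv n).1.kernel_le ht
    · filter_upwards [ae_restrict_mem measurableSet_Ioi] with t ht
      exact (hJ t (hy.trans ht)).const_mul _
  obtain ⟨p, hp⟩ := hA.exists_isRadialProfile fun y hy => by
    refine tendsto_nhds_unique (hT y hy) ?_
    have := (tendsto_add_atTop_iff_nat 1).2 (hlim y hy)
    simpa only [hsucc] using this
  exact ⟨h, p, hp, fun y hy => ⟨hlo y hy, hup y hy⟩⟩

/-! ### Monotonicity and decay of the profile -/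

theorem exists_isLocalMax_mem_Ioo {f : ℝ → ℝ} {a b c : ℝ} (hf : ContinuousOn f (Icc a b))
    (hc : c ∈ Ioo a b) (ha : f a ≤ f c) (hb : f b ≤ f c) :
    ∃ z ∈ Ioo a b, IsLocalMax f z ∧ f c ≤ f z := by
  obtain ⟨z, hz, hmax⟩ := isCompact_Icc.exists_isMaxOn ⟨c, Ioo_subset_Icc_self hc⟩ hf
  have hcz : f c ≤ f z := hmax (Ioo_subset_Icc_self hc)
  by_cases h : z ∈ Ioo a b
  · exact ⟨z, h, hmax.isLocalMax (Icc_mem_nhds h.1 h.2), hcz⟩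
  · have hzc : f z ≤ f c := by
      rcases hz.1.eq_or_lt with rfl | h1
      · exact ha
      rcases hz.2.eq_or_lt with rfl | h2
      · exact hb
      exact absurd ⟨h1, h2⟩ h
    have hmax' : IsMaxOn f (Icc a b) c := fun w hw => (hmax hw).trans hzc
    exact ⟨c, hc, hmax'.isLocalMax (Icc_mem_nhds hc.1 hc.2), le_rfl⟩

/-- The solution of the vortex equation constructed between the barriers, as a function of
`y = r²`. -/
structure IsBarrierProfile (h p : ℝ → ℝ) : Prop extends IsRadialProfile h p where
  lower : ∀ y, 0 < y → vortexBarrier 4 y ≤ h y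
  upper : ∀ y, 0 < y → h y ≤ vortexBarrier 1 y

theorem IsRadialProfile.hasDerivAt_radial {h p : ℝ → ℝ} (H : IsRadialProfile h p) {r : ℝ}
    (hr : 0 < r) : HasDerivAt (fun r => r * h (r ^ 2)) (p (r ^ 2)) r := by
  have h2 := hasDerivAt_pow 2 r
  refine ((hasDerivAt_id r).mul
    ((H.hasDerivAt_fst (r ^ 2) (by positivity)).comp r h2)).congr_deriv ?_
  simp only [Nat.cast_ofNat, Nat.add_one_sub_one, pow_one, id, Function.comp]
  field_simp
  ring

theorem IsRadialProfile.hasDerivAt_radial_deriv {h p : ℝ → ℝ} (H : IsRadialProfile h p) {r : ℝ}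
    (hr : 0 < r) : HasDerivAt (fun r => p (r ^ 2))
      ((h (r ^ 2) - p (r ^ 2)) / r - r * (1 - r ^ 2 * h (r ^ 2) ^ 2) * h (r ^ 2)) r := by
  have h2 := hasDerivAt_pow 2 r
  refine ((H.hasDerivAt_snd (r ^ 2) (by positivity)).comp r h2).congr_deriv ?_
  simp only [Nat.cast_ofNat, Nat.add_one_sub_one, pow_one]
  field_simp

namespace IsBarrierProfile

variable {h p : ℝ → ℝ}

theorem pos (B : IsBarrierProfile h p) {y : ℝ} (hy : 0 < y) : 0 < h y :=
  (vortexBarrier_pos (by linarith)).trans_le (B.lower y hy)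

theorem add_mul_sq_le (B : IsBarrierProfile h p) {y : ℝ} (hy : 0 < y) :
    (y + 1) * h y ^ 2 ≤ 1 := by
  have h1 := B.upper y hy
  have h2 := B.pos hy
  refine le_trans ?_ (add_mul_vortexBarrier_sq (c := 1) (y := y) (by linarith)).le
  gcongr

theorem le_add_mul_sq (B : IsBarrierProfile h p) {y : ℝ} (hy : 0 < y) :
    1 ≤ (y + 4) * h y ^ 2 := by
  have h1 := B.lower y hy
  have h2 := vortexBarrier_pos (c := 4) (y := y) (by linarith)
  refine (add_mul_vortexBarrier_sq (c := 4) (y := y) (by linarith)).ge.trans ?_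
  gcongr

theorem le_one (B : IsBarrierProfile h p) {y : ℝ} (hy : 0 < y) : h y ≤ 1 := by
  have := B.add_mul_sq_le hy
  have := B.pos hy
  by_contra hlt
  push Not at hlt
  nlinarith

theorem mul_lt_one (B : IsBarrierProfile h p) {r : ℝ} (hr : 0 < r) : r * h (r ^ 2) < 1 := by
  have h1 := B.add_mul_sq_le (y := r ^ 2) (by positivity)
  have h2 := B.pos (y := r ^ 2) (by positivity)
  refine lt_of_pow_lt_pow_left₀ 2 zero_le_one ?_
  nlinarith [pow_pos h2 2]

/-- `1 - ρ²` is at most `4 / r²`. -/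
theorem mul_defect_le (B : IsBarrierProfile h p) {y : ℝ} (hy : 0 < y) :
    y * (1 - y * h y ^ 2) ≤ 4 := by
  have h1 := B.le_add_mul_sq hy
  have h2 := B.add_mul_sq_le hy
  nlinarith [sq_nonneg (h y)]

theorem defect_pos (B : IsBarrierProfile h p) {y : ℝ} (hy : 0 < y) :
    0 < 1 - y * h y ^ 2 := by
  have h2 := B.add_mul_sq_le hy
  nlinarith [pow_pos (B.pos hy) 2]

theorem tendsto_mul_sq (B : IsBarrierProfile h p) :
    Tendsto (fun y => y * h y ^ 2) atTop (𝓝 1) := by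
  have h1 : Tendsto (fun y : ℝ => 1 - 4 / y) atTop (𝓝 1) := by
    simpa using (tendsto_const_nhds.div_atTop tendsto_id : Tendsto (fun y : ℝ => (4 : ℝ) / y)
      atTop (𝓝 0)).const_sub 1
  refine tendsto_of_tendsto_of_tendsto_of_le_of_le' h1 tendsto_const_nhds ?_ ?_
  · filter_upwards [eventually_gt_atTop 0] with y hy
    have := B.mul_defect_le hy
    rw [sub_le_comm, le_div_iff₀ hy]
    linarith
  · filter_upwards [eventually_gt_atTop 0] with y hy
    linarith [B.defect_pos hy]

theorem tendsto_radial (B : IsBarrierProfile h p) :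
    Tendsto (fun r => r * h (r ^ 2)) atTop (𝓝 1) := by
  have h1 : Tendsto (fun r : ℝ => √(r ^ 2 * h (r ^ 2) ^ 2)) atTop (𝓝 √1) :=
    (Real.continuous_sqrt.tendsto 1).comp
      (B.tendsto_mul_sq.comp (tendsto_pow_atTop two_ne_zero))
  rw [Real.sqrt_one] at h1
  refine h1.congr' ?_
  filter_upwards [eventually_gt_atTop 0] with r hr
  have := B.pos (y := r ^ 2) (by positivity)
  rw [← mul_pow, Real.sqrt_sq (by positivity)]

/-- At a critical point, `ρ''` has the sign of `1 - r² (1 - ρ²)`. If monotonicity failed there would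
be a local maximum `r₁` and a later local minimum `r₂` with `ρ r₂ ≤ ρ r₁`. The test gives `r₁² (1 -
ρ(r₁)²) ≥ 1 ≥ r₂² (1 - ρ(r₂)²)`, impossible for `r₁ < r₂`. -/
theorem strictMonoOn_radial (B : IsBarrierProfile h p) :
    StrictMonoOn (fun r => r * h (r ^ 2)) (Ioi 0) := by
  set ρ : ℝ → ℝ := fun r => r * h (r ^ 2) with hρ
  have hd : ∀ r, 0 < r → HasDerivAt ρ (p (r ^ 2)) r := fun r hr => B.hasDerivAt_radial hr
  have hpos : ∀ r, 0 < r → 0 < ρ r := fun r hr => mul_pos hr (B.pos (by positivity))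
  intro a ha b hb hab
  by_contra hlt
  push Not at hlt
  have ha : 0 < a := ha
  have hb : 0 < b := hb
  -- Since `ρ δ ≤ δ`, this left end point lies below `ρ a`, which makes the maximum interior.
  set δ := min a (ρ a) / 2 with hδ
  have hm : 0 < min a (ρ a) := lt_min ha (hpos a ha)
  have hδ0 : 0 < δ := by positivity
  have hδa : δ < a := by have := min_le_left a (ρ a); linarith
  have hδρ : ρ δ ≤ ρ a := by
    have h1 : ρ δ ≤ δ * 1 := mul_le_mul_of_nonneg_left (B.le_one (by positivity)) hδ0.le
    have h2 := min_le_right a (ρ a)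
    linarith
  obtain ⟨r₁, hr₁, hmax, hr₁a⟩ := exists_isLocalMax_mem_Ioo (f := ρ) (a := δ) (b := b) (c := a)
    (fun z hz => (hd z (hδ0.trans_le hz.1)).continuousAt.continuousWithinAt) ⟨hδa, hab⟩ hδρ hlt
  have hr₁0 : 0 < r₁ := hδ0.trans hr₁.1
  obtain ⟨R, hR, hRb⟩ := ((B.tendsto_radial.eventually_const_lt (B.mul_lt_one hb)).and
    (eventually_gt_atTop b)).exists
  obtain ⟨r₂, hr₂, hmin, hr₂b⟩ := exists_isLocalMax_mem_Ioo (f := fun r => -ρ r) (a := r₁) (b := R)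
    (c := b) (fun z hz => (hd z (hr₁0.trans_le hz.1)).continuousAt.neg.continuousWithinAt)
    ⟨hr₁.2, hRb⟩ (neg_le_neg (hlt.trans hr₁a)) (neg_le_neg hR.le)
  have hr₂0 : 0 < r₂ := hr₁0.trans hr₂.1
  have e₁ := hmax.hasDerivAt_eq_zero (hd r₁ hr₁0)
  have e₂ := hmin.hasDerivAt_eq_zero (hd r₂ hr₂0).neg
  have s₁ := hmax.second_deriv_nonpos ((lt_mem_nhds hr₁0).mono hd)
    (B.hasDerivAt_radial_deriv hr₁0)
  have s₂ := hmin.second_deriv_nonpos ((lt_mem_nhds hr₂0).mono fun r hr => (hd r hr).neg)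
    (B.hasDerivAt_radial_deriv hr₂0).neg
  have e₂' : p (r₂ ^ 2) = 0 := by linarith
  rw [e₁] at s₁
  rw [e₂'] at s₂
  have hle : ρ r₂ ^ 2 ≤ ρ r₁ ^ 2 := by
    have := hpos r₂ hr₂0
    have : ρ r₂ ≤ ρ r₁ := by linarith
    gcongr
  have q₁ := B.pos (y := r₁ ^ 2) (by positivity)
  have q₂ := B.pos (y := r₂ ^ 2) (by positivity)
  have d₁ := B.defect_pos (y := r₁ ^ 2) (by positivity)
  simp only [hρ, mul_pow] at hle
  have t₁ : 1 ≤ r₁ ^ 2 * (1 - r₁ ^ 2 * h (r₁ ^ 2) ^ 2) := by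
    have : (h (r₁ ^ 2) - 0) / r₁ - r₁ * (1 - r₁ ^ 2 * h (r₁ ^ 2) ^ 2) * h (r₁ ^ 2)
      = (h (r₁ ^ 2) / r₁) * (1 - r₁ ^ 2 * (1 - r₁ ^ 2 * h (r₁ ^ 2) ^ 2)) := by field_simp; ring
    rw [this] at s₁
    have := nonpos_of_mul_nonpos_right s₁ (by positivity)
    linarith
  have t₂ : r₂ ^ 2 * (1 - r₂ ^ 2 * h (r₂ ^ 2) ^ 2) ≤ 1 := by
    have : -((h (r₂ ^ 2) - 0) / r₂ - r₂ * (1 - r₂ ^ 2 * h (r₂ ^ 2) ^ 2) * h (r₂ ^ 2))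
      = (h (r₂ ^ 2) / r₂) * (r₂ ^ 2 * (1 - r₂ ^ 2 * h (r₂ ^ 2) ^ 2) - 1) := by field_simp; ring
    rw [this] at s₂
    have := nonpos_of_mul_nonpos_right s₂ (by positivity)
    linarith
  have hr : r₁ ^ 2 < r₂ ^ 2 := by
    have := hr₂.1
    gcongr
  nlinarith

theorem deriv_nonneg (B : IsBarrierProfile h p) {y : ℝ} (hy : 0 < y) : 0 ≤ p y := by
  have hs := Real.sqrt_pos.2 hy
  have h1 := B.hasDerivAt_radial hs
  rw [Real.sq_sqrt hy.le] at h1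
  rw [← h1.deriv, ← derivWithin_of_isOpen isOpen_Ioi hs]
  exact B.strictMonoOn_radial.monotoneOn.derivWithin_nonneg

/-- `ρ'(r) ≤ 12 / r²` for `r ≥ 1`. -/
theorem mul_deriv_le (B : IsBarrierProfile h p) {y : ℝ} (hy : 1 ≤ y) : y * p y ≤ 12 := by
  obtain ⟨r, hr, rfl⟩ : ∃ r, 1 ≤ r ∧ y = r ^ 2 :=
    ⟨√y, Real.one_le_sqrt.2 hy, (Real.sq_sqrt (by linarith)).symm⟩
  have hr0 : 0 < r := by linarith
  -- The mean value theorem bounds `ρ'` at one point `ξ` of `(r, r + 1)` by `1 - ρ(r) ≤ 4 / r²`.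
  obtain ⟨ξ, hξ, hslope⟩ := exists_hasDerivAt_eq_slope (fun r => r * h (r ^ 2))
    (fun r => p (r ^ 2)) (by linarith : r < r + 1)
    (fun z hz => (B.hasDerivAt_radial (hr0.trans_le hz.1)).continuousAt.continuousWithinAt)
    (fun z hz => B.hasDerivAt_radial (hr0.trans hz.1))
  have hξ0 : 0 < ξ := hr0.trans hξ.1
  have hpξ : r ^ 2 * p (ξ ^ 2) ≤ 4 := by
    have h1 := B.mul_lt_one (r := r + 1) (by linarith)
    have h2 := B.mul_defect_le (y := r ^ 2) (by positivity)
    have h3 := B.mul_lt_one hr0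
    have h4 := B.pos (y := r ^ 2) (by positivity)
    have h5 : p (ξ ^ 2) ≤ 1 - r * h (r ^ 2) := by
      rw [hslope]; simp only [add_sub_cancel_left, div_one]; linarith
    have h6 : 1 - r * h (r ^ 2) ≤ 1 - r ^ 2 * h (r ^ 2) ^ 2 := by
      have : 0 < r * h (r ^ 2) := by positivity
      nlinarith
    have : r ^ 2 * p (ξ ^ 2) ≤ r ^ 2 * (1 - r ^ 2 * h (r ^ 2) ^ 2) := by
      have := h5.trans h6
      gcongr
    linarith
  have hd : ∀ s, 0 < s → HasDerivAt (fun s => s * p (s ^ 2) + 4 / r * s)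
      (h (s ^ 2) * (1 - s ^ 2 * (1 - s ^ 2 * h (s ^ 2) ^ 2)) + 4 / r) s := by
    intro s hs
    refine (((hasDerivAt_id s).mul (B.hasDerivAt_radial_deriv hs)).add
      ((hasDerivAt_id s).const_mul (4 / r))).congr_deriv ?_
    simp only [id]
    field_simp
    ring
  -- `(s ρ'(s))' = h (1 - s² (1 - ρ²)) ≥ -3 h ≥ -3 / r` transports the bound from `ξ` back to `r`,
  -- at a cost of at most `4 / r`. With `ξ ≤ 2 r` the total is `8 + 4 = 12`.
  have hmono : MonotoneOn (fun s => s * p (s ^ 2) + 4 / r * s) (Ici r) := by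
    refine monotoneOn_of_hasDerivWithinAt_nonneg (convex_Ici r)
      (fun s hs => (hd s (hr0.trans_le hs)).continuousAt.continuousWithinAt)
      (fun s hs => (hd s (hr0.trans_le (interior_subset hs))).hasDerivWithinAt) fun s hs => ?_
    have hrs : r ≤ s := interior_subset hs
    have hs0 := hr0.trans_le hrs
    have h1 := B.pos (y := s ^ 2) (by positivity)
    have h2 := B.mul_defect_le (y := s ^ 2) (by positivity)
    have h3 := B.mul_lt_one hs0
    have h4 : h (s ^ 2) ≤ 1 / r := by
      rw [le_div_iff₀ hr0]
      nlinarith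
    have h5 : h (s ^ 2) * 4 ≤ 1 / r * 4 := by gcongr
    have h6 : 4 / r = 1 / r * 4 := by ring
    nlinarith
  have := hmono self_mem_Ici hξ.1.le hξ.1.le
  simp only [div_mul_cancel₀ _ hr0.ne'] at this
  have h7 : ξ * p (ξ ^ 2) * r ≤ 8 := by
    have h8 := B.deriv_nonneg (y := ξ ^ 2) (by positivity)
    have : ξ ≤ 2 * r := by linarith [hξ.2]
    calc ξ * p (ξ ^ 2) * r ≤ 2 * r * p (ξ ^ 2) * r := by gcongr
      _ ≤ 8 := by nlinarith
  have h9 : 4 / r * ξ * r ≤ 4 * r + 4 := by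
    have : 4 / r * ξ * r = 4 * ξ := by field_simp
    rw [this]; linarith [hξ.2]
  nlinarith

end IsBarrierProfile

/-! ### Sharp asymptotics and decay of the derivatives of `1 - ρ²` -/

theorem abs_mul_le_div_pow {a b A B t : ℝ} {m n : ℕ} (ha : |a| ≤ A / t ^ m)
    (hb : |b| ≤ B / t ^ n) : |a * b| ≤ A * B / t ^ (m + n) := by
  rw [abs_mul, pow_add, mul_div_mul_comm]
  exact mul_le_mul ha hb (abs_nonneg _) ((abs_nonneg _).trans ha)

theorem div_pow_le_div_pow_of_one_le {A t : ℝ} {m n : ℕ} (hA : 0 ≤ A) (ht : 1 ≤ t) (hmn : n ≤ m) :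
    A / t ^ m ≤ A / t ^ n := by
  have := pow_le_pow_right₀ ht hmn
  gcongr

theorem abs_combination_le_div {a b A B D T s t : ℝ} (hT : 0 < T) (ha : |a| ≤ A / T)
    (hb : |b| ≤ B / T) (hD : |s| * A + |t| * B ≤ D) : |s * a + t * b| ≤ D / T := by
  rw [le_div_iff₀ hT] at *
  calc |s * a + t * b| * T ≤ (|s| * |a| + |t| * |b|) * T := by
        rw [← abs_mul, ← abs_mul]; gcongr; exact abs_add_le _ _
    _ = |s| * (|a| * T) + |t| * (|b| * T) := by ring
    _ ≤ |s| * A + |t| * B := by gcongr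
    _ ≤ D := hD

namespace IsBarrierProfile

variable {h p : ℝ → ℝ}

/-- Comparison with the barriers that are subsolutions near infinity. -/
theorem exists_barrier_le (B : IsBarrierProfile h p) {c : ℝ} (hc : 1 < c) :
    ∃ M Y : ℝ, 0 ≤ M ∧ 8 ≤ Y ∧ ∀ y, Y ≤ y → vortexBarrier c y ≤ h y + M / y ^ 2 := by
  -- The condition on `c` says that the barrier is a subsolution beyond `Y`. The bound `8 ≤ Y` gives
  -- `z h² ≥ 2/3`, and lets the linear term absorb the correction `Y² / z²`.
  obtain ⟨Y, hY8, hYc⟩ : ∃ Y : ℝ, 8 ≤ Y ∧ 4 * c - c ^ 2 ≤ (c - 1) * Y := by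
    refine ⟨max 8 ((4 * c - c ^ 2) / (c - 1)), le_max_left _ _, ?_⟩
    have := le_max_right 8 ((4 * c - c ^ 2) / (c - 1))
    rw [div_le_iff₀ (by linarith)] at this
    linarith
  have hY0 : 0 < Y := by linarith
  have hdb : ∀ y, 0 < y → HasDerivAt (vortexBarrier c) (-(vortexBarrier c y ^ 3) / 2) y :=
    fun y hy => hasDerivAt_vortexBarrier (by linarith)
  -- With `M = Y²` the correction equals `1` at `y = Y`, where the barrier is at most `1`.
  refine ⟨Y ^ 2, Y, by positivity, hY8, fun y hy => ?_⟩
  set d : ℝ → ℝ := fun y => vortexBarrier c y - h y - Y ^ 2 / y ^ 2 with hd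
  have hd1 : ∀ y, 0 < y → HasDerivAt d
      (-(vortexBarrier c y ^ 3) / 2 - (p y - h y) / (2 * y) + 2 * Y ^ 2 / y ^ 3) y := by
    intro y hy
    refine (((hdb y hy).sub (B.hasDerivAt_fst y hy)).sub
      ((hasDerivAt_const y (Y ^ 2)).div (hasDerivAt_pow 2 y) (by positivity))).congr_deriv ?_
    push_cast
    field_simp
    ring
  have hd2 : ∀ y, 0 < y → HasDerivAt
      (fun y => -(vortexBarrier c y ^ 3) / 2 - (p y - h y) / (2 * y) + 2 * Y ^ 2 / y ^ 3)
      (3 / 4 * vortexBarrier c y ^ 5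
        - (-((1 - y * h y ^ 2) * h y / 4) - (p y - h y) / y) / y - 6 * Y ^ 2 / y ^ 4) y := by
    intro y hy
    refine ((((((hdb y hy).pow 3).neg).div_const 2).sub
      (((B.hasDerivAt_snd y hy).sub (B.hasDerivAt_fst y hy)).div
        ((hasDerivAt_id y).const_mul 2) (by simp [hy.ne']))).add
      ((hasDerivAt_const y (2 * Y ^ 2)).div (hasDerivAt_pow 3 y) (by positivity))).congr_deriv ?_
    simp only [id, Pi.sub_apply]
    push_cast
    field_simp
    ring
  have hle1 : ∀ z, 0 < z → vortexBarrier c z ^ 2 ≤ z⁻¹ := fun z hz => by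
    rw [vortexBarrier_sq (by linarith)]
    exact inv_anti₀ hz (by linarith)
  have hdY : d Y ≤ 0 := by
    have h1 := hle1 Y hY0
    have h2 := B.pos hY0
    have h3 : Y⁻¹ ≤ 1 := inv_le_one_of_one_le₀ (by linarith)
    have h4 : vortexBarrier c Y ≤ 1 := by nlinarith
    simp only [hd, div_self (pow_ne_zero 2 hY0.ne')]
    linarith
  have hlim : ∀ ε > 0, ∃ Z, y < Z ∧ d Z ≤ ε := by
    intro ε hε
    refine ⟨max (y + 1) ((ε ^ 2)⁻¹), by have := le_max_left (y + 1) ((ε ^ 2)⁻¹); linarith, ?_⟩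
    set Z := max (y + 1) ((ε ^ 2)⁻¹)
    have hZ0 : 0 < Z := by have := le_max_left (y + 1) ((ε ^ 2)⁻¹); linarith
    have h1 := hle1 Z hZ0
    have h2 : Z⁻¹ ≤ ε ^ 2 := inv_le_of_inv_le₀ (by positivity) (le_max_right _ _)
    have h3 : vortexBarrier c Z ≤ ε := abs_le_of_sq_le_sq' (h1.trans h2) hε.le |>.2
    have h4 := B.pos hZ0
    have h5 : 0 ≤ Y ^ 2 / Z ^ 2 := by positivity
    simp only [hd]
    linarith
  have hdy : d y ≤ 0 := by
    refine le_of_forall_pos_le_add fun ε hε => ?_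
    obtain ⟨Z, hyZ, hdZ⟩ := hlim ε hε
    have := nonpos_of_second_deriv_pos (p := Y) (q := Z) (f := fun y => d y - ε)
      (fun z hz => ((hd1 z (hY0.trans_le hz.1)).sub_const ε).continuousAt.continuousWithinAt)
      (fun z hz => (hd1 z (hY0.trans hz.1)).sub_const ε) (fun z hz => hd2 z (hY0.trans hz.1))
      (by linarith) (by linarith) (fun z hz hpos hcrit => ?_) y ⟨hy, hyZ.le⟩
    · linarith
    · have hz0 := hY0.trans hz.1
      have hzY := hz.1
      set u := vortexBarrier c z with hu
      have hu0 : 0 < u := vortexBarrier_pos (by linarith)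
      have hh0 := B.pos hz0
      have e := add_mul_vortexBarrier_sq (c := c) (y := z) (by linarith)
      rw [← hu] at e
      have hlow := B.le_add_mul_sq hz0
      have hdz : Y ^ 2 / z ^ 2 < u - h z := by simp only [hd] at hpos; linarith
      have hq0 : 0 < Y ^ 2 / z ^ 2 := by positivity
      have hhu : h z < u := by linarith
      have hzh : 2 / 3 ≤ z * h z ^ 2 := by nlinarith [sq_nonneg (h z)]
      have hR : 0 ≤ c - 1 - 3 * c * u ^ 2 := by
        have h1 : 0 ≤ (c - 1) * (z + c) - 3 * c := by nlinarith
        have h2 : c - 1 - 3 * c * u ^ 2 = ((c - 1) * (z + c) - 3 * c) * u ^ 2 := by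
          linear_combination -(c - 1) * e
        rw [h2]
        positivity
      -- At a critical point the first order terms drop out of the difference of the two equations,
      -- leaving the residual of the barrier, the difference of the nonlinearities, and the
      -- contribution of the correction.
      have key : z * (3 / 4 * u ^ 5 - (-((1 - z * h z ^ 2) * h z / 4) - (p z - h z) / z) / z
          - 6 * Y ^ 2 / z ^ 4)
          = u ^ 3 / 4 * (c - 1 - 3 * c * u ^ 2)
            + (u - h z) * (z * (u ^ 2 + u * h z + h z ^ 2) - 1) / 4
            - 2 * (Y ^ 2 / z ^ 2) / z := by
        have hcrit' : (p z - h z) / z = -u ^ 3 + 4 * Y ^ 2 / z ^ 3 := by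
          have : (p z - h z) / z = 2 * ((p z - h z) / (2 * z)) := by field_simp
          rw [this]
          linear_combination (-2) * hcrit
        rw [hcrit']
        field_simp
        linear_combination (3 * z ^ 3 * u ^ 3 - z ^ 3 * u) * e
      refine pos_of_mul_pos_right (a := z) ?_ hz0.le
      rw [key]
      have h1 : 0 ≤ u ^ 3 / 4 * (c - 1 - 3 * c * u ^ 2) := mul_nonneg (by positivity) hR
      have h2 : 1 ≤ z * (u ^ 2 + u * h z + h z ^ 2) - 1 := by
        have : z * (3 * h z ^ 2) ≤ z * (u ^ 2 + u * h z + h z ^ 2) := by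
          refine mul_le_mul_of_nonneg_left ?_ hz0.le
          nlinarith
        linarith
      have h3 : u - h z ≤ (u - h z) * (z * (u ^ 2 + u * h z + h z ^ 2) - 1) :=
        le_mul_of_one_le_right (by linarith) h2
      have h4 : 2 * (Y ^ 2 / z ^ 2) / z ≤ (Y ^ 2 / z ^ 2) / 4 := by
        rw [div_le_div_iff₀ hz0 four_pos]
        nlinarith
      linarith
  simp only [hd] at hdy
  linarith

/-- `1 - ρ² = 1 / r² + o(1 / r²)`. -/
theorem tendsto_mul_defect (B : IsBarrierProfile h p) :
    Tendsto (fun y => y * (1 - y * h y ^ 2)) atTop (𝓝 1) := by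
  rw [tendsto_order]
  constructor
  · intro a ha
    have h1 : Tendsto (fun y : ℝ => 1 - 1 / y) atTop (𝓝 1) := by
      simpa using (tendsto_const_nhds.div_atTop tendsto_id : Tendsto (fun y : ℝ => (1 : ℝ) / y)
        atTop (𝓝 0)).const_sub 1
    filter_upwards [h1.eventually_const_lt ha, eventually_gt_atTop 0] with y hya hy
    refine hya.trans_le ?_
    have h2 := B.add_mul_sq_le hy
    have h4 : h y ^ 2 ≤ (y + 1)⁻¹ := by
      rw [← one_div, le_div_iff₀ (by linarith)]; linarith
    have h5 : y / (y + 1) ≤ y * (1 - y * h y ^ 2) := by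
      rw [div_eq_mul_inv]
      refine mul_le_mul_of_nonneg_left ?_ hy.le
      have : (y + 1)⁻¹ = 1 - y * (y + 1)⁻¹ := by field_simp; ring
      rw [this]
      nlinarith
    refine le_trans ?_ h5
    rw [le_div_iff₀ (by linarith)]
    have : (1 - 1 / y) * (y + 1) = y - 1 / y := by field_simp; ring
    rw [this]
    have : 0 < 1 / y := by positivity
    linarith
  · intro a ha
    -- The barrier with this `c` in `(1, a)` has `y (1 - y u²) ≤ c`; replacing `u` by `h` costs
    -- `O(y^{-1/2})`, as `u - h ≤ M / y²` and `u + h = O(y^{-1/2})`.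
    set c := 1 + min 1 (a - 1) / 2 with hc
    have hm : 0 < min 1 (a - 1) := lt_min one_pos (by linarith)
    have hc1 : 1 < c := by linarith
    have hca : c < a := by have := min_le_right 1 (a - 1); linarith
    obtain ⟨M, Y, hM, hY, hle⟩ := B.exists_barrier_le hc1
    have h1 : Tendsto (fun y : ℝ => c + 2 * M / √y) atTop (𝓝 c) := by
      simpa using (tendsto_const_nhds.div_atTop Real.tendsto_sqrt_atTop :
        Tendsto (fun y : ℝ => 2 * M / √y) atTop (𝓝 0)).const_add c
    filter_upwards [h1.eventually_lt_const hca, eventually_ge_atTop Y] with y hya hyY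
    refine lt_of_le_of_lt ?_ hya
    have hy : 0 < y := by linarith
    have hs : 0 < √y := Real.sqrt_pos.2 hy
    have hss : √y ^ 2 = y := Real.sq_sqrt hy.le
    have e := add_mul_vortexBarrier_sq (c := c) (y := y) (by linarith)
    set u := vortexBarrier c y
    have hu0 : 0 < u := vortexBarrier_pos (by linarith)
    have hh0 := B.pos hy
    have hu1 : u * √y ≤ 1 := by
      refine le_of_sq_le_sq ?_ zero_le_one
      rw [mul_pow, hss]
      nlinarith [sq_nonneg u]
    have hcu : y * (1 - y * u ^ 2) ≤ c := by
      have : y * (1 - y * u ^ 2) = c * (y * u ^ 2) := by linear_combination (-y) * e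
      rw [this]
      have : y * u ^ 2 ≤ 1 := by nlinarith [sq_nonneg u]
      nlinarith
    have hmain : y ^ 2 * (u ^ 2 - h y ^ 2) ≤ 2 * M / √y := by
      rcases le_total u (h y) with hlt | hlt
      · have : y ^ 2 * (u ^ 2 - h y ^ 2) ≤ 0 :=
          mul_nonpos_of_nonneg_of_nonpos (by positivity) (by nlinarith)
        exact this.trans (by positivity)
      · have h2 : y ^ 2 * (u - h y) ≤ M := by
          have := hle y hyY
          have h3 : u - h y ≤ M / y ^ 2 := by linarith
          rwa [le_div_iff₀ (by positivity), mul_comm] at h3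
        have h4 : (u + h y) * √y ≤ 2 := by nlinarith
        rw [le_div_iff₀ hs]
        calc y ^ 2 * (u ^ 2 - h y ^ 2) * √y = (y ^ 2 * (u - h y)) * ((u + h y) * √y) := by ring
          _ ≤ M * 2 := mul_le_mul h2 h4 (by positivity) hM
          _ = 2 * M := by ring
    nlinarith

/-- The first three derivatives of `1 - ρ²` with respect to `y = r²`. -/
theorem hasDerivAt_defect (B : IsBarrierProfile h p) {y : ℝ} (hy : 0 < y) :
    HasDerivAt (fun y => 1 - y * h y ^ 2) (-(h y * p y)) y ∧
    HasDerivAt (fun y => -(h y * p y))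
      (-(p y - h y) ^ 2 / (2 * y) + (1 - y * h y ^ 2) * h y ^ 2 / 2) y ∧
    HasDerivAt (fun y => -(p y - h y) ^ 2 / (2 * y) + (1 - y * h y ^ 2) * h y ^ 2 / 2)
      ((p y - h y) * ((2 * (p y - h y) / y + (1 - y * h y ^ 2) * h y) * (1 / y) / 2)
        + (p y - h y) ^ 2 * (1 / y * (1 / y)) / 2 - h y * p y * (h y * h y) / 2
        + (1 - y * h y ^ 2) * (h y * ((p y - h y) * (1 / y))) / 2) y := by
  have h1 := B.hasDerivAt_fst y hy
  have h2 := B.hasDerivAt_snd y hy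
  have h3 : HasDerivAt (fun y => 1 - y * h y ^ 2) (-(h y * p y)) y := by
    refine (((hasDerivAt_id y).mul (h1.pow 2)).const_sub 1).congr_deriv ?_
    simp only [id, Pi.pow_apply]
    push_cast
    field_simp
    ring
  refine ⟨h3, ((h1.mul h2).neg).congr_deriv ?_, ?_⟩
  · field_simp
    ring
  · refine (((((h2.sub h1).pow 2).neg).div ((hasDerivAt_id y).const_mul 2)
      (by simp [hy.ne'])).add ((h3.mul (h1.pow 2)).div_const 2)).congr_deriv ?_
    simp only [id, Pi.pow_apply, Pi.sub_apply, Pi.neg_apply]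
    push_cast
    field_simp
    ring

/-- Each derivative in `y` is a polynomial in `1 - ρ²`, `h`, `p`, `p - h` and `1 / y`, of orders
`-2, -1, -2, -1, -2` in `√y`. One power of `√y` per derivative is enough, since a derivative in `x`
of a function of `|x|²` produces just one factor `x`. -/
theorem abs_defect_derivs_le (B : IsBarrierProfile h p) {y : ℝ} (hy : 1 ≤ y) :
    |1 - y * h y ^ 2| ≤ 200 / √y ^ 2 ∧ |-(h y * p y)| ≤ 200 / √y ^ 3 ∧
    |-(p y - h y) ^ 2 / (2 * y) + (1 - y * h y ^ 2) * h y ^ 2 / 2| ≤ 200 / √y ^ 4 ∧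
    |(p y - h y) * ((2 * (p y - h y) / y + (1 - y * h y ^ 2) * h y) * (1 / y) / 2)
        + (p y - h y) ^ 2 * (1 / y * (1 / y)) / 2 - h y * p y * (h y * h y) / 2
        + (1 - y * h y ^ 2) * (h y * ((p y - h y) * (1 / y))) / 2| ≤ 400 / √y ^ 5 := by
  have hy0 : 0 < y := by linarith
  have ht1 : 1 ≤ √y := Real.one_le_sqrt.2 hy
  have ht : 0 < √y := by linarith
  have hty : √y ^ 2 = y := Real.sq_sqrt hy0.le
  have bW : |1 - y * h y ^ 2| ≤ 4 / √y ^ 2 := by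
    rw [abs_of_pos (B.defect_pos hy0), le_div_iff₀ (by positivity), hty]
    linarith [B.mul_defect_le hy0]
  have bh : |h y| ≤ 1 / √y ^ 1 := by
    rw [abs_of_pos (B.pos hy0), le_div_iff₀ (by positivity), pow_one]
    have := B.mul_lt_one ht
    rw [hty] at this
    linarith
  have bp : |p y| ≤ 12 / √y ^ 2 := by
    rw [abs_of_nonneg (B.deriv_nonneg hy0), le_div_iff₀ (by positivity), hty]
    linarith [B.mul_deriv_le hy]
  have hyi : |1 / y| ≤ 1 / √y ^ 2 := by rw [abs_of_pos (by positivity), hty]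
  have bd : |p y - h y| ≤ 13 / √y ^ 1 := by
    have h1 := bp.trans (div_pow_le_div_pow_of_one_le (by norm_num) ht1 (by norm_num : 1 ≤ 2))
    have h2 : (13 : ℝ) / √y ^ 1 = 12 / √y ^ 1 + 1 / √y ^ 1 := by ring
    rw [h2]
    exact (abs_sub _ _).trans (add_le_add h1 bh)
  have low : ∀ {A : ℝ} (m n : ℕ), 0 ≤ A → n ≤ m → A / √y ^ m ≤ A / √y ^ n :=
    fun m n hA hmn => div_pow_le_div_pow_of_one_le hA ht1 hmn
  have bdd := abs_mul_le_div_pow bd bd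
  have bhh := abs_mul_le_div_pow bh bh
  have bhp := abs_mul_le_div_pow bh bp
  have byy := abs_mul_le_div_pow hyi hyi
  have bdy := abs_mul_le_div_pow bd hyi
  have bWh := abs_mul_le_div_pow bW bh
  refine ⟨bW.trans (by gcongr; norm_num), ?_, ?_, ?_⟩
  · rw [abs_neg]
    exact bhp.trans (by norm_num; gcongr; norm_num)
  · have e : -(p y - h y) ^ 2 / (2 * y) + (1 - y * h y ^ 2) * h y ^ 2 / 2
        = (-1 / 2) * ((p y - h y) * (p y - h y) * (1 / y))
          + (1 / 2) * ((1 - y * h y ^ 2) * (h y * h y)) := by field_simp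
    rw [e]
    exact abs_combination_le_div (by positivity) (abs_mul_le_div_pow bdd hyi)
      (abs_mul_le_div_pow bW bhh) (by norm_num [abs_div])
  · have h0 : |2 * (p y - h y) / y + (1 - y * h y ^ 2) * h y| ≤ 30 / √y ^ 3 := by
      have e : 2 * (p y - h y) / y + (1 - y * h y ^ 2) * h y
          = 2 * ((p y - h y) * (1 / y)) + 1 * ((1 - y * h y ^ 2) * h y) := by field_simp
      rw [e]
      exact abs_combination_le_div (by positivity) bdy bWh (by norm_num)
    have h1 := (abs_mul_le_div_pow bd (abs_mul_le_div_pow h0 hyi)).trans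
      (low _ 5 (by norm_num) (by norm_num))
    have h2 := (abs_mul_le_div_pow bdd byy).trans (low _ 5 (by norm_num) (by norm_num))
    have h3 := abs_mul_le_div_pow bhp bhh
    have h4 := (abs_mul_le_div_pow bW (abs_mul_le_div_pow bh bdy)).trans
      (low _ 5 (by norm_num) (by norm_num))
    have h5 := abs_combination_le_div (s := 1 / 2) (t := 1 / 2) (D := 300) (by positivity) h1 h2
      (by norm_num [abs_div])
    have h6 := abs_combination_le_div (s := -1 / 2) (t := 1 / 2) (D := 50) (by positivity) h3 h4
      (by norm_num [abs_div])
    have h7 := abs_combination_le_div (s := 1) (t := 1) (D := 400) (by positivity) h5 h6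
      (by norm_num)
    convert h7 using 2
    ring

/-- `1 - ρ²` is a smooth function of `y = r²` up to the origin, and its derivatives decay. -/
theorem exists_smooth_defect (B : IsBarrierProfile h p) :
    ∃ W : ℕ → ℝ → ℝ, (∀ y, 0 < y → W 0 y = 1 - y * h y ^ 2) ∧ W 0 0 = 1 ∧
      (∀ j, ContDiffOn ℝ ∞ (W j) (Ici 0)) ∧
      (∀ j, ∀ y ∈ Ici (0 : ℝ), HasDerivWithinAt (W j) (W (j + 1) y) (Ici 0) y) ∧
      ∃ C, ∀ j ≤ 3, ∀ y, 0 ≤ y → |W j y| ≤ C / √(1 + y) ^ (j + 2) := by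
  obtain ⟨g, hgh, hgC, -, -⟩ := B.exists_contDiffOn_extension
  set V : ℝ → ℝ := fun y => 1 - y * g y ^ 2 with hV
  have hVC : ContDiffOn ℝ ∞ V (Ici 0) := contDiffOn_const.sub (contDiffOn_id.mul (hgC.pow 2))
  set W : ℕ → ℝ → ℝ := fun j => iteratedDerivWithin j V (Ici 0) with hW
  have hU := uniqueDiffOn_Ici (0 : ℝ)
  have hWC : ∀ j, ContDiffOn ℝ ∞ (W j) (Ici 0) := by
    intro j
    induction j with
    | zero => simpa [hW] using hVC
    | succ j ih =>
      simp only [hW, iteratedDerivWithin_succ]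
      exact ((contDiffOn_infty_iff_derivWithin hU).1 ih).2
  have hWd : ∀ j, ∀ y ∈ Ici (0 : ℝ), HasDerivWithinAt (W j) (W (j + 1) y) (Ici 0) y := by
    intro j y hy
    have := ((hWC j).differentiableOn (by simp) y hy).hasDerivWithinAt
    simpa only [hW, iteratedDerivWithin_succ] using this
  have hW0 : ∀ y, 0 < y → W 0 y = 1 - y * h y ^ 2 := fun y hy => by
    simp [hW, hV, hgh hy]
  have hstep : ∀ (j : ℕ) (f f' : ℝ → ℝ), (∀ y, 0 < y → W j y = f y) →
      (∀ y, 0 < y → HasDerivAt f (f' y) y) → ∀ y, 0 < y → W (j + 1) y = f' y := by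
    intro j f f' h1 h2 y hy
    have h3 := ((h2 y hy).congr_of_eventuallyEq (f₁ := W j)
      (by filter_upwards [lt_mem_nhds hy] with z hz using h1 z hz))
    exact ((hWd j y hy.le).hasDerivAt (Ici_mem_nhds hy)).unique h3
  have hW1 := hstep 0 _ _ hW0 fun y hy => (B.hasDerivAt_defect hy).1
  have hW2 := hstep 1 _ _ hW1 fun y hy => (B.hasDerivAt_defect hy).2.1
  have hW3 := hstep 2 _ _ hW2 fun y hy => (B.hasDerivAt_defect hy).2.2
  refine ⟨W, hW0, by simp [hW, hV], hWC, hWd, ?_⟩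
  have hnear : ∀ j, ∃ K, ∀ y ∈ Icc (0 : ℝ) 1, ‖W j y‖ ≤ K := fun j =>
    isCompact_Icc.exists_bound_of_continuousOn ((hWC j).continuousOn.mono Icc_subset_Ici_self)
  choose K hK using hnear
  have hfar : ∀ j ≤ 3, ∀ y, 1 ≤ y → |W j y| ≤ 400 / √y ^ (j + 2) := by
    intro j hj y hy
    have hy0 : 0 < y := by linarith
    have hs := Real.sqrt_pos.2 hy0
    obtain ⟨b0, b1, b2, b3⟩ := B.abs_defect_derivs_le hy
    have h24 : ∀ n, (200 : ℝ) / √y ^ n ≤ 400 / √y ^ n := fun n => by gcongr; norm_num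
    interval_cases j
    · rw [hW0 y hy0]; exact b0.trans (h24 2)
    · rw [hW1 y hy0]; exact b1.trans (h24 3)
    · rw [hW2 y hy0]; exact b2.trans (h24 4)
    · rw [hW3 y hy0]; exact b3
  -- Passing from `√y` to `√(1 + y) ≤ 2 √y` costs at most `2 ^ 5 = 32`; the sum covers the compact
  -- range `y ≤ 1`.
  refine ⟨32 * (400 + ∑ j ∈ Finset.range 4, |K j|), fun j hj y hy => ?_⟩
  set S := ∑ j ∈ Finset.range 4, |K j|
  have hS0 : 0 ≤ S := Finset.sum_nonneg fun _ _ => abs_nonneg _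
  have hKS : |K j| ≤ S := Finset.single_le_sum (f := fun j => |K j|) (fun _ _ => abs_nonneg _)
    (Finset.mem_range.2 (by omega))
  have hs : 0 < √(1 + y) := Real.sqrt_pos.2 (by linarith)
  rw [le_div_iff₀ (by positivity)]
  have h32 : (2 : ℝ) ^ (j + 2) ≤ 32 := by
    calc (2 : ℝ) ^ (j + 2) ≤ 2 ^ 5 := pow_le_pow_right₀ (by norm_num) (by omega)
      _ = 32 := by norm_num
  rcases le_total y 1 with hy1 | hy1
  · have h1 : |W j y| ≤ S := (hK j y ⟨hy, hy1⟩).trans ((le_abs_self _).trans hKS)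
    have h2 : √(1 + y) ≤ 2 := Real.sqrt_le_iff.2 ⟨by norm_num, by linarith⟩
    have h3 : √(1 + y) ^ (j + 2) ≤ 32 := (pow_le_pow_left₀ hs.le h2 _).trans h32
    calc |W j y| * √(1 + y) ^ (j + 2) ≤ S * 32 := by gcongr
      _ ≤ _ := by linarith
  · have hs' : 0 < √y := Real.sqrt_pos.2 (by linarith)
    have h1 := hfar j hj y hy1
    rw [le_div_iff₀ (by positivity)] at h1
    have h2 : √(1 + y) ≤ 2 * √y := by
      rw [Real.sqrt_le_iff]
      refine ⟨by positivity, ?_⟩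
      rw [mul_pow, Real.sq_sqrt (by linarith)]
      linarith
    calc |W j y| * √(1 + y) ^ (j + 2) ≤ |W j y| * (2 * √y) ^ (j + 2) := by gcongr
      _ = 2 ^ (j + 2) * (|W j y| * √y ^ (j + 2)) := by rw [mul_pow]; ring
      _ ≤ 32 * 400 := by gcongr
      _ ≤ _ := by linarith

end IsBarrierProfile

/-! ### Symbol estimates, uniform over families, in the plane -/

theorem contDiff_partialDeriv {f : Plane → ℂ} (hf : ContDiff ℝ ∞ f) (k : Fin 2) :
    ContDiff ℝ ∞ (partialDeriv k f) := by
  unfold partialDeriv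
  exact (hf.fderiv_right (m := ∞) (by simp)).clm_apply contDiff_const

theorem partialDeriv_add {f g : Plane → ℂ} (hf : ContDiff ℝ ∞ f) (hg : ContDiff ℝ ∞ g)
    (k : Fin 2) : partialDeriv k (f + g) = partialDeriv k f + partialDeriv k g := by
  ext x
  have hf' := hf.differentiable (by simp) x
  have hg' := hg.differentiable (by simp) x
  simp [partialDeriv, fderiv_add hf' hg']

theorem partialDeriv_mul {f g : Plane → ℂ} (hf : ContDiff ℝ ∞ f) (hg : ContDiff ℝ ∞ g)
    (k : Fin 2) : partialDeriv k (f * g) = f * partialDeriv k g + partialDeriv k f * g := by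
  ext x
  have hf' := hf.differentiable (by simp) x
  have hg' := hg.differentiable (by simp) x
  simp [partialDeriv, fderiv_mul hf' hg']
  ring

theorem partialDeriv_const (c : ℂ) (k : Fin 2) : partialDeriv k (fun _ => c) = fun _ => 0 := by
  ext x
  simp [partialDeriv]

theorem partialDeriv_eq_zero_of_isOpen {f : Plane → ℂ} {s : Set Plane} (hs : IsOpen s)
    (hf : ∀ x ∈ s, f x = 0) (k : Fin 2) : ∀ x ∈ s, partialDeriv k f x = 0 := by
  intro x hx
  have : f =ᶠ[𝓝 x] fun _ => 0 := by filter_upwards [hs.mem_nhds hx] with z hz using hf z hz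
  simp [partialDeriv, this.fderiv_eq]

theorem multiDeriv_eq_zero_of_isOpen {f : Plane → ℂ} {s : Set Plane} (hs : IsOpen s)
    (hf : ∀ x ∈ s, f x = 0) (α : ℕ × ℕ) : ∀ x ∈ s, multiDeriv α f x = 0 := by
  have h : ∀ (k : Fin 2) (n : ℕ) (g : Plane → ℂ), (∀ x ∈ s, g x = 0) →
      ∀ x ∈ s, (partialDeriv k)^[n] g x = 0 := by
    intro k n
    induction n with
    | zero => exact fun g hg => hg
    | succ n ih => exact fun g hg => ih _ (partialDeriv_eq_zero_of_isOpen hs hg k)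
  exact h 0 α.1 _ (h 1 α.2 f hf)

/-- Families of smooth functions whose derivatives up to order `n` are bounded, uniformly on the
family, by a multiple of `⟨x⟩ᵐ`. -/
def IsSymbolFamily {ι : Type*} : ℕ → ℤ → (ι → Plane → ℂ) → Prop
  | 0, m, f => (∀ i, ContDiff ℝ ∞ (f i)) ∧ ∃ C : ℝ, ∀ i x, ‖f i x‖ ≤ C * √(1 + ‖x‖ ^ 2) ^ m
  | n + 1, m, f => ((∀ i, ContDiff ℝ ∞ (f i)) ∧
      ∃ C : ℝ, ∀ i x, ‖f i x‖ ≤ C * √(1 + ‖x‖ ^ 2) ^ m) ∧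
      ∀ k, IsSymbolFamily n m fun i => partialDeriv k (f i)

theorem one_le_sqrt_one_add_norm_sq (x : Plane) : 1 ≤ √(1 + ‖x‖ ^ 2) :=
  Real.one_le_sqrt.2 (by have := sq_nonneg ‖x‖; linarith)

namespace IsSymbolFamily

variable {ι : Type*} {n : ℕ} {m m' : ℤ} {f g : ι → Plane → ℂ}

theorem base (h : IsSymbolFamily n m f) : IsSymbolFamily 0 m f := by
  cases n with
  | zero => exact h
  | succ n => exact h.1

theorem contDiff (h : IsSymbolFamily n m f) (i : ι) : ContDiff ℝ ∞ (f i) := h.base.1 i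

theorem of_succ (h : IsSymbolFamily (n + 1) m f) : IsSymbolFamily n m f := by
  induction n generalizing f with
  | zero => exact h.1
  | succ n ih => exact ⟨h.1, fun k => ih (h.2 k)⟩

theorem mono_exp (h : IsSymbolFamily n m f) (hm : m ≤ m') : IsSymbolFamily n m' f := by
  have key : ∀ f : ι → Plane → ℂ, IsSymbolFamily 0 m f → IsSymbolFamily 0 m' f := by
    rintro f ⟨h1, C, hC⟩
    refine ⟨h1, max C 0, fun i x => (hC i x).trans ?_⟩
    have := one_le_sqrt_one_add_norm_sq x
    exact mul_le_mul (le_max_left _ _) (zpow_le_zpow_right₀ this hm) (by positivity)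
      (le_max_right _ _)
  induction n generalizing f with
  | zero => exact key f h
  | succ n ih => exact ⟨key f h.1, fun k => ih (h.2 k)⟩

theorem comp {κ : Type*} (h : IsSymbolFamily n m f) (e : κ → ι) :
    IsSymbolFamily n m fun j => f (e j) := by
  have key : ∀ f : ι → Plane → ℂ, IsSymbolFamily 0 m f →
      IsSymbolFamily 0 m fun j => f (e j) := by
    rintro f ⟨h1, C, hC⟩
    exact ⟨fun j => h1 (e j), C, fun j => hC (e j)⟩
  induction n generalizing f with
  | zero => exact key f h
  | succ n ih => exact ⟨key f h.1, fun k => ih (h.2 k)⟩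

theorem add (hf : IsSymbolFamily n m f) (hg : IsSymbolFamily n m g) :
    IsSymbolFamily n m fun i => f i + g i := by
  have key : ∀ f g : ι → Plane → ℂ, IsSymbolFamily 0 m f → IsSymbolFamily 0 m g →
      IsSymbolFamily 0 m fun i => f i + g i := by
    rintro f g ⟨h1, C, hC⟩ ⟨h2, D, hD⟩
    refine ⟨fun i => (h1 i).add (h2 i), C + D, fun i x => ?_⟩
    rw [add_mul]
    exact (norm_add_le _ _).trans (add_le_add (hC i x) (hD i x))
  induction n generalizing f g with
  | zero => exact key f g hf hg
  | succ n ih =>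
    refine ⟨key f g hf.1 hg.1, fun k => ?_⟩
    simp only [partialDeriv_add (hf.contDiff _) (hg.contDiff _)]
    exact ih (hf.2 k) (hg.2 k)

theorem mul (hf : IsSymbolFamily n m f) (hg : IsSymbolFamily n m' g) :
    IsSymbolFamily n (m + m') fun i => f i * g i := by
  have key : ∀ f g : ι → Plane → ℂ, IsSymbolFamily 0 m f → IsSymbolFamily 0 m' g →
      IsSymbolFamily 0 (m + m') fun i => f i * g i := by
    rintro f g ⟨h1, C, hC⟩ ⟨h2, D, hD⟩
    refine ⟨fun i => (h1 i).mul (h2 i), C * D, fun i x => ?_⟩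
    have hpos : 0 < √(1 + ‖x‖ ^ 2) := by have := one_le_sqrt_one_add_norm_sq x; linarith
    change ‖f i x * g i x‖ ≤ _
    rw [zpow_add₀ hpos.ne', mul_mul_mul_comm, norm_mul]
    exact mul_le_mul (hC i x) (hD i x) (norm_nonneg _) ((norm_nonneg _).trans (hC i x))
  induction n generalizing f g with
  | zero => exact key f g hf hg
  | succ n ih =>
    refine ⟨key f g hf.1 hg.1, fun k => ?_⟩
    simp only [partialDeriv_mul (hf.contDiff _) (hg.contDiff _)]
    exact (ih hf.of_succ (hg.2 k)).add (ih (hf.2 k) hg.of_succ)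

theorem const {c : ι → ℂ} {C : ℝ} (hc : ∀ i, ‖c i‖ ≤ C) :
    IsSymbolFamily n 0 fun i (_ : Plane) => c i := by
  have key : ∀ (c : ι → ℂ) (C : ℝ), (∀ i, ‖c i‖ ≤ C) →
      IsSymbolFamily 0 0 fun i (_ : Plane) => c i := fun c C hc =>
    ⟨fun i => contDiff_const, C, fun i x => by simpa using hc i⟩
  induction n generalizing c C with
  | zero => exact key c C hc
  | succ n ih =>
    refine ⟨key c C hc, fun k => ?_⟩
    simp only [partialDeriv_const]
    exact ih (C := 0) (by simp)

theorem sub (hf : IsSymbolFamily n m f) (hg : IsSymbolFamily n m g) :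
    IsSymbolFamily n m fun i => f i - g i := by
  have h1 := (const (n := n) (c := fun _ : ι => (-1 : ℂ)) (C := 1) (by simp)).mul hg
  rw [zero_add] at h1
  refine (congrArg (IsSymbolFamily n m) ?_).mp (hf.add h1)
  ext i x
  simp [sub_eq_add_neg]

theorem coord (j : Fin 2) : IsSymbolFamily n 1 fun (_ : ι) (x : Plane) => ((x j : ℝ) : ℂ) := by
  have hd : ∀ x : Plane, HasFDerivAt (fun x : Plane => ((x j : ℝ) : ℂ))
      (Complex.ofRealCLM.comp (EuclideanSpace.proj j : Plane →L[ℝ] ℝ)) x := fun x =>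
    (Complex.ofRealCLM.comp (EuclideanSpace.proj j : Plane →L[ℝ] ℝ)).hasFDerivAt
  have h0 : IsSymbolFamily 0 1 fun (_ : ι) (x : Plane) => ((x j : ℝ) : ℂ) := by
    refine ⟨fun _ => (Complex.ofRealCLM.comp
      (EuclideanSpace.proj j : Plane →L[ℝ] ℝ)).contDiff, 1, fun _ x => ?_⟩
    rw [Complex.norm_real, one_mul, zpow_one]
    refine (PiLp.norm_apply_le x j).trans (Real.le_sqrt_of_sq_le (by linarith))
  cases n with
  | zero => exact h0
  | succ n =>
    refine ⟨h0, fun k => ?_⟩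
    have : partialDeriv k (fun x : Plane => ((x j : ℝ) : ℂ))
        = fun _ => (((EuclideanSpace.single k (1 : ℝ) : Plane) j : ℝ) : ℂ) := by
      ext x
      simp [partialDeriv, (hd x).fderiv]
    simp only [this]
    exact (const (C := ‖(((EuclideanSpace.single k (1 : ℝ) : Plane) j : ℝ) : ℂ)‖)
      fun _ => le_rfl).mono_exp zero_le_one

/-- Radial functions `W(|x|²)` with decaying derivatives. -/
theorem radial {W : ℕ → ℝ → ℝ} {N : ℕ} {C : ℝ} (hW : ∀ j, ContDiffOn ℝ ∞ (W j) (Ici 0))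
    (hd : ∀ j, ∀ y ∈ Ici (0 : ℝ), HasDerivWithinAt (W j) (W (j + 1) y) (Ici 0) y)
    (hC : ∀ j ≤ N, ∀ y, 0 ≤ y → |W j y| ≤ C / √(1 + y) ^ (j + 2)) {n j : ℕ} (hj : j + n ≤ N) :
    IsSymbolFamily n (-(j + 2 : ℕ)) fun (_ : ι) (x : Plane) => ((W j (‖x‖ ^ 2) : ℝ) : ℂ) := by
  have key : ∀ j ≤ N,
      IsSymbolFamily 0 (-(j + 2 : ℕ)) fun (_ : ι) (x : Plane) => ((W j (‖x‖ ^ 2) : ℝ) : ℂ) := by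
    intro j hj
    refine ⟨fun _ => Complex.ofRealCLM.contDiff.comp ?_, C, fun _ x => ?_⟩
    · have h1 : ContDiffOn ℝ ∞ (fun x : Plane => ‖x‖ ^ 2) univ :=
        (contDiff_norm_sq ℝ).contDiffOn
      exact contDiffOn_univ.1 ((hW j).comp h1 fun x _ => sq_nonneg ‖x‖)
    · rw [Complex.norm_real, zpow_neg, zpow_natCast, ← div_eq_mul_inv]
      exact hC j hj _ (sq_nonneg _)
  induction n generalizing j with
  | zero => exact key j hj
  | succ n ih =>
    refine ⟨key j (by omega), fun k => ?_⟩
    -- The factor `2 x_k` has order `1` and `W (j + 1)` order `-(j + 3)`, so the order `-(j + 2)` is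
    -- preserved.
    have h1 : partialDeriv k (fun x : Plane => ((W j (‖x‖ ^ 2) : ℝ) : ℂ))
        = (fun _ => (2 : ℂ)) * (fun x : Plane => ((x k : ℝ) : ℂ))
          * fun x : Plane => ((W (j + 1) (‖x‖ ^ 2) : ℝ) : ℂ) := by
      ext x
      have h2 : HasFDerivAt (fun x : Plane => W j (‖x‖ ^ 2))
          (W (j + 1) (‖x‖ ^ 2) • ((2 : ℕ) • innerSL ℝ x)) x := by
        rw [← hasFDerivWithinAt_univ]
        exact (hd j (‖x‖ ^ 2) (mem_Ici.2 (sq_nonneg _))).comp_hasFDerivWithinAt x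
          (hasStrictFDerivAt_norm_sq x).hasFDerivAt.hasFDerivWithinAt fun z _ => sq_nonneg ‖z‖
      have h3 := (Complex.ofRealCLM.hasFDerivAt (x := W j (‖x‖ ^ 2))).comp x h2
      have h4 : partialDeriv k (fun x : Plane => ((W j (‖x‖ ^ 2) : ℝ) : ℂ)) x
          = ((W (j + 1) (‖x‖ ^ 2) * (2 * inner ℝ x (EuclideanSpace.single k (1 : ℝ))) : ℝ) : ℂ) := by
        rw [partialDeriv]
        erw [h3.fderiv]
        simp
      rw [h4]
      simp only [EuclideanSpace.inner_single_right, Pi.mul_apply]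
      push_cast
      simp
      ring
    simp only [h1]
    have h5 := ((const (ι := ι) (n := n) (c := fun _ => (2 : ℂ)) (C := 2) (by simp)).mul
      (coord k)).mul (ih (j := j + 1) (by omega))
    refine (congrArg (fun m => IsSymbolFamily n m _) ?_).mp h5
    push_cast
    ring

/-- Dilations of a test function. -/
theorem dilation {χ : Plane → ℂ} (hχ : IsTestFunction χ) {ε : ι → ℝ} (hε : ∀ i, |ε i| ≤ 1) :
    IsSymbolFamily n 0 fun (i : ι) (x : Plane) => χ (ε i • x) := by
  have key : ∀ χ : Plane → ℂ, IsTestFunction χ →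
      IsSymbolFamily 0 0 fun (i : ι) (x : Plane) => χ (ε i • x) := by
    intro χ hχ
    obtain ⟨C, hC⟩ := hχ.2.exists_bound_of_continuous hχ.1.continuous
    exact ⟨fun i => hχ.1.comp (contDiff_const_smul (ε i)), C, fun i x => by simpa using hC _⟩
  induction n generalizing χ with
  | zero => exact key χ hχ
  | succ n ih =>
    refine ⟨key χ hχ, fun k => ?_⟩
    -- Each derivative brings out a factor `ε i` of modulus at most `1`, which keeps the bounds
    -- uniform in the dilation.
    have h1 : ∀ i, partialDeriv k (fun x : Plane => χ (ε i • x))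
        = (fun _ => (ε i : ℂ)) * fun x => partialDeriv k χ (ε i • x) := by
      intro i
      ext x
      have h2 : HasFDerivAt (fun x : Plane => χ (ε i • x))
          ((fderiv ℝ χ (ε i • x)).comp (ε i • ContinuousLinearMap.id ℝ Plane)) x :=
        (hχ.1.differentiable (by simp) _).hasFDerivAt.comp x
          ((ε i • ContinuousLinearMap.id ℝ Plane).hasFDerivAt)
      simp [partialDeriv, h2.fderiv]
    simp only [h1]
    have h3 : IsTestFunction (partialDeriv k χ) :=
      ⟨contDiff_partialDeriv hχ.1 k, (hχ.2.fderiv_apply (𝕜 := ℝ) _)⟩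
    have := (const (n := n) (c := fun i => (ε i : ℂ)) (C := 1) fun i => by
      rw [Complex.norm_real]; exact hε i).mul (ih h3)
    rwa [zero_add] at this

theorem iterate {k : Fin 2} {a : ℕ} (h : IsSymbolFamily (n + a) m f) :
    IsSymbolFamily n m fun i => (partialDeriv k)^[a] (f i) := by
  induction a generalizing f with
  | zero => exact h
  | succ a ih => exact ih (h.2 k)

theorem multi_partialDeriv {α : ℕ × ℕ} (h : IsSymbolFamily (n + (α.1 + α.2)) m f) :
    IsSymbolFamily n m fun i => multiDeriv α (f i) := by
  unfold multiDeriv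
  rw [← add_assoc] at h
  exact iterate (iterate h)

theorem of_le {n' : ℕ} (h : IsSymbolFamily n m f) (hn : n' ≤ n) : IsSymbolFamily n' m f := by
  induction n, hn using Nat.le_induction with
  | base => exact h
  | succ n _ ih => exact ih h.of_succ

end IsSymbolFamily

/-! ### Density of test functions and weighted Sobolev membership -/

/-- The square integrable function that dominates the weighted derivatives. -/
noncomputable def weightTail (γ : ℝ) (N : ℕ) : Plane → ℝ :=
  (Metric.ball (0 : Plane) N)ᶜ.indicator fun x => (1 + ‖x‖ ^ 2) ^ (γ / 2 - 1)

theorem tendsto_eLpNorm_weightTail {γ : ℝ} (hγ : γ < 1) :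
    Tendsto (fun N => eLpNorm (weightTail γ N) 2 volume) atTop (𝓝 0) := by
  have hpos : ∀ x : Plane, 0 < 1 + ‖x‖ ^ 2 := fun x => by positivity
  -- The squared weight is `⟨x⟩^{-(4 - 2γ)}`, integrable in dimension two because `4 - 2γ > 2`.
  have hint : Integrable (fun x : Plane => ((1 : ℝ) + ‖x‖ ^ 2) ^ (-(4 - 2 * γ) / 2)) volume :=
    integrable_rpow_neg_one_add_norm_sq (by
      rw [finrank_euclideanSpace_fin]; push_cast; linarith)
  have hcont : Continuous fun x : Plane => (1 + ‖x‖ ^ 2) ^ (γ / 2 - 1) :=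
    Continuous.rpow_const (by fun_prop) fun x => Or.inl (hpos x).ne'
  have hmeas : ∀ N, Measurable (weightTail γ N) := fun N =>
    hcont.measurable.indicator Metric.isOpen_ball.measurableSet.compl
  have hlim : Tendsto (fun N => ∫⁻ x, ‖weightTail γ N x‖ₑ ^ (2 : ℝ)) atTop
      (𝓝 (∫⁻ _ : Plane, 0)) := by
    refine tendsto_lintegral_of_dominated_convergence
      (fun x : Plane => ‖(1 + ‖x‖ ^ 2) ^ (-(4 - 2 * γ) / 2)‖ₑ)
      (fun N => (hmeas N).enorm.pow_const _) (fun N => Eventually.of_forall fun x => ?_)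
      hint.2.ne (Eventually.of_forall fun x => ?_)
    · have h1 : ‖weightTail γ N x‖ₑ ≤ ‖(1 + ‖x‖ ^ 2) ^ (γ / 2 - 1)‖ₑ :=
        enorm_indicator_le_enorm_self _ _
      calc ‖weightTail γ N x‖ₑ ^ (2 : ℝ) ≤ ‖(1 + ‖x‖ ^ 2) ^ (γ / 2 - 1)‖ₑ ^ (2 : ℝ) := by gcongr
        _ = ‖(1 + ‖x‖ ^ 2) ^ (-(4 - 2 * γ) / 2)‖ₑ := by
          rw [ENNReal.rpow_ofNat, ← enorm_pow, ← Real.rpow_natCast, ← Real.rpow_mul (hpos x).le]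
          congr 2
          push_cast
          ring
    · refine tendsto_const_nhds.congr' ?_
      obtain ⟨M, hM⟩ := exists_nat_gt ‖x‖
      filter_upwards [eventually_ge_atTop M] with N hN
      have : x ∈ Metric.ball (0 : Plane) N := by
        rw [mem_ball_zero_iff]
        exact hM.trans_le (by exact_mod_cast hN)
      simp [weightTail, this]
  have h2 := (ENNReal.continuous_rpow_const (y := 1 / 2)).tendsto (0 : ℝ≥0∞)
  rw [lintegral_zero] at hlim
  have h3 := h2.comp hlim
  simp only [one_div, ENNReal.zero_rpow_of_pos (by norm_num : (0 : ℝ) < 2⁻¹)] at h3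
  refine h3.congr fun N => ?_
  rw [eLpNorm_eq_lintegral_rpow_enorm_toReal (by norm_num) (by norm_num)]
  simp

/-- Families of functions that decay like `⟨x⟩⁻²` and vanish on large balls are small in the
weighted norms. -/
theorem IsSymbolFamily.tendsto_weightedL2Norm {ι : Type*} {l : Filter ι} {N : ι → ℕ}
    {f : ι → Plane → ℂ} {n : ℕ} {γ : ℝ} (hγ : γ < 1) (hf : IsSymbolFamily n (-2) f)
    (hN : Tendsto N l atTop) (h0 : ∀ i, ∀ x ∈ Metric.ball (0 : Plane) (N i), f i x = 0)
    {α : ℕ × ℕ} (hα : α.1 + α.2 ≤ n) :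
    Tendsto (fun i => weightedL2Norm γ (multiDeriv α (f i))) l (𝓝 0) := by
  obtain ⟨-, C, hC⟩ := ((hf.of_le hα).of_le (by omega : 0 + (α.1 + α.2) ≤ α.1 + α.2)).multi_partialDeriv
  have hbound : ∀ i, weightedL2Norm γ (multiDeriv α (f i))
      ≤ ENNReal.ofReal C * eLpNorm (weightTail γ (N i)) 2 volume := by
    intro i
    refine eLpNorm_le_mul_eLpNorm_of_ae_le_mul (Eventually.of_forall fun x => ?_) 2
    have hpos : 0 < 1 + ‖x‖ ^ 2 := by positivity
    by_cases hx : x ∈ Metric.ball (0 : Plane) (N i)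
    · simp [multiDeriv_eq_zero_of_isOpen Metric.isOpen_ball (h0 i) α x hx, weightTail, hx]
    · have h1 : weightTail γ (N i) x = (1 + ‖x‖ ^ 2) ^ (γ / 2 - 1) :=
        indicator_of_mem (mem_compl hx) _
      have h2 := hC i x
      rw [zpow_neg, zpow_ofNat, Real.sq_sqrt hpos.le] at h2
      rw [h1, norm_mul, Complex.norm_real, japaneseWeight,
        Real.norm_of_nonneg (Real.rpow_nonneg hpos.le _),
        Real.norm_of_nonneg (Real.rpow_nonneg hpos.le _), Real.rpow_sub_one hpos.ne']
      calc (1 + ‖x‖ ^ 2) ^ (γ / 2) * ‖multiDeriv α (f i) x‖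
          ≤ (1 + ‖x‖ ^ 2) ^ (γ / 2) * (C * (1 + ‖x‖ ^ 2)⁻¹) := by gcongr
        _ = C * ((1 + ‖x‖ ^ 2) ^ (γ / 2) / (1 + ‖x‖ ^ 2)) := by ring
  have hlim : Tendsto (fun i => ENNReal.ofReal C * eLpNorm (weightTail γ (N i)) 2 volume) l
      (𝓝 0) := by
    have := ENNReal.Tendsto.const_mul (a := ENNReal.ofReal C)
      ((tendsto_eLpNorm_weightTail hγ).comp hN) (Or.inr ENNReal.ofReal_ne_top)
    simpa using this
  exact tendsto_of_tendsto_of_tendsto_of_le_of_le tendsto_const_nhds hlim (fun _ => zero_le)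
    hbound

/-- Smooth functions with derivatives of order `⟨x⟩⁻²` belong to the weighted Sobolev spaces. -/
theorem memWeightedSobolev_of_isSymbolFamily {u : Plane → ℂ} {s : ℕ} {γ : ℝ} (hγ : γ < 1)
    (hu : IsSymbolFamily s (-2) fun _ : Unit => u) : MemWeightedSobolev s γ u := by
  have huC : ContDiff ℝ ∞ u := hu.contDiff ()
  let b : ContDiffBump (0 : Plane) := ⟨1, 2, one_pos, one_lt_two⟩
  set χ : Plane → ℂ := fun x => ((b x : ℝ) : ℂ) with hχ
  have hχt : IsTestFunction χ :=
    ⟨Complex.ofRealCLM.contDiff.comp b.contDiff,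
      b.hasCompactSupport.comp_left (g := fun t : ℝ => (t : ℂ)) Complex.ofReal_zero⟩
  set ε : ℕ → ℝ := fun n => ((n : ℝ) + 1)⁻¹ with hεdef
  have hε0 : ∀ n, 0 < ε n := fun n => by positivity
  have hε : ∀ n, |ε n| ≤ 1 := fun n => by
    rw [abs_of_pos (hε0 n)]
    exact inv_le_one_of_one_le₀ (by have : (0 : ℝ) ≤ n := n.cast_nonneg; linarith)
  -- The cutoff equals `1` on the ball of radius `n + 1`, so `φ n - u` and `φ n - φ m` vanish on
  -- large balls while obeying symbol bounds uniform in the indices.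
  set φ : ℕ → Plane → ℂ := fun n => (fun x => χ (ε n • x)) * u with hφ
  have hφs : IsSymbolFamily s (-2) φ := by
    have := (IsSymbolFamily.dilation (n := s) hχt hε).mul (hu.comp fun _ : ℕ => ())
    rwa [zero_add] at this
  have hφu : ∀ n : ℕ, ∀ x ∈ Metric.ball (0 : Plane) n, φ n x = u x := by
    intro n x hx
    have h1 : ε n • x ∈ Metric.closedBall (0 : Plane) b.rIn := by
      rw [mem_closedBall_zero_iff, norm_smul, Real.norm_of_nonneg (hε0 n).le]
      rw [mem_ball_zero_iff] at hx
      change ((n : ℝ) + 1)⁻¹ * ‖x‖ ≤ 1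
      rw [inv_mul_le_iff₀ (by positivity)]
      linarith
    simp [hφ, hχ, b.one_of_mem_closedBall h1]
  have hφt : ∀ n, IsTestFunction (φ n) := fun n =>
    ⟨hφs.contDiff n, (hχt.2.comp_smul (hε0 n).ne').mul_right⟩
  refine ⟨huC.continuous.aestronglyMeasurable, φ, hφt, ?_, ?_⟩
  · have hmin : Tendsto (fun p : ℕ × ℕ => min p.1 p.2) atTop atTop := by
      refine tendsto_atTop.2 fun b => ?_
      filter_upwards [eventually_ge_atTop (b, b)] with p hp
      exact le_min hp.1 hp.2
    have hsymb : IsSymbolFamily s (-2) fun p : ℕ × ℕ => φ p.1 - φ p.2 :=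
      (hφs.comp Prod.fst).sub (hφs.comp Prod.snd)
    have hz : ∀ p : ℕ × ℕ, ∀ x ∈ Metric.ball (0 : Plane) (min p.1 p.2 : ℕ),
        (φ p.1 - φ p.2) x = 0 := by
      intro p x hx
      have h1 : x ∈ Metric.ball (0 : Plane) p.1 :=
        Metric.ball_subset_ball (by exact_mod_cast min_le_left _ _) hx
      have h2 : x ∈ Metric.ball (0 : Plane) p.2 :=
        Metric.ball_subset_ball (by exact_mod_cast min_le_right _ _) hx
      rw [Pi.sub_apply, hφu _ x h1, hφu _ x h2, sub_self]
    unfold weightedSobolevNorm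
    rw [show (0 : ℝ≥0∞) = ∑ k ∈ Finset.range (s + 1),
      ∑ α ∈ Finset.HasAntidiagonal.antidiagonal k, 0 by simp]
    refine tendsto_finsetSum _ fun k hk => tendsto_finsetSum _ fun α hα => ?_
    refine hsymb.tendsto_weightedL2Norm hγ hmin hz ?_
    rw [Finset.HasAntidiagonal.mem_antidiagonal] at hα
    rw [Finset.mem_range] at hk
    omega
  · have hsymb : IsSymbolFamily s (-2) fun n => φ n - u := hφs.sub (hu.comp fun _ : ℕ => ())
    exact hsymb.tendsto_weightedL2Norm (α := (0, 0)) hγ tendsto_id (fun n x hx => by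
      rw [Pi.sub_apply, hφu n x hx, sub_self]) (Nat.zero_le _)

/-! ### Assembly of the theorem -/

/-- A classical solution of the vortex equation as a solution of the first order system. -/
theorem IsVortexProfile.isRadialProfile {σ : ℝ → ℝ} (hσ : IsVortexProfile σ) :
    IsRadialProfile (fun y => σ √y / √y) (fun y => deriv σ √y) := by
  have h2 : ContDiffOn ℝ (1 + 1) σ (Ioi 0) := by simpa [one_add_one_eq_two] using hσ.contDiffOn
  have hC := (contDiffOn_succ_iff_deriv_of_isOpen isOpen_Ioi).1 h2
  have hd : ∀ r, 0 < r → HasDerivAt σ (deriv σ r) r := fun r hr =>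
    (hC.1.differentiableAt (Ioi_mem_nhds hr)).hasDerivAt
  have hd2 : ∀ r, 0 < r → HasDerivAt (deriv σ) (deriv (deriv σ) r) r := fun r hr =>
    ((hC.2.2.differentiableOn one_ne_zero).differentiableAt (Ioi_mem_nhds hr)).hasDerivAt
  constructor
  · intro y hy
    have hs := Real.sqrt_pos.2 hy
    have hsq := Real.hasDerivAt_sqrt hy.ne'
    refine (((hd _ hs).comp y hsq).div hsq hs.ne').congr_deriv ?_
    have e : √y ^ 2 = y := Real.sq_sqrt hy.le
    simp only [Function.comp]
    rw [← e]
    simp only [Real.sqrt_sq hs.le]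
    field_simp
  · intro y hy
    have hs := Real.sqrt_pos.2 hy
    refine ((hd2 _ hs).comp y (Real.hasDerivAt_sqrt hy.ne')).congr_deriv ?_
    have e : √y ^ 2 = y := Real.sq_sqrt hy.le
    have hode := hσ.ode _ hs
    have h3 : deriv (deriv σ) √y = -(1 / √y * deriv σ √y) + 1 / √y ^ 2 * σ √y
      - (1 - σ √y ^ 2) * σ √y := by linarith
    rw [h3, ← e]
    simp only [Real.sqrt_sq hs.le]
    field_simp
    ring

theorem mainTheorem5 :
    ∃ ρ : ℝ → ℝ,
      -- existence and uniqueness on the open half-line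
      IsVortexProfile ρ ∧
      (∀ σ : ℝ → ℝ, IsVortexProfile σ → EqOn σ ρ (Ioi 0)) ∧
      -- continuously differentiable up to the origin, twice up to infinity
      ContDiffOn ℝ 1 ρ (Ici 0) ∧
      Tendsto (deriv ρ) atTop (𝓝 0) ∧
      Tendsto (deriv (deriv ρ)) atTop (𝓝 0) ∧
      -- positive and increasing, of order r at the origin
      (∀ r : ℝ, 0 < r → 0 < ρ r) ∧
      StrictMonoOn ρ (Ioi 0) ∧
      (ρ =O[𝓝[>] 0] fun r : ℝ => r) ∧
      -- decay at infinity
      ((fun r : ℝ => 1 - ρ r) =O[atTop] fun r : ℝ => 1 / r ^ 2) ∧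
      ((fun r : ℝ => (1 - ρ r ^ 2) - 1 / r ^ 2) =o[atTop] fun r : ℝ => 1 / r ^ 2) ∧
      (∀ γ : ℝ, 0 < γ → γ < 1 →
        (fun x : Plane => ((1 - ρ ‖x‖ ^ 2 : ℝ) : ℂ)) ∈ radialWeightedSobolev 3 γ) := by
  obtain ⟨h, p, H, hbar⟩ := exists_isRadialProfile
  have B : IsBarrierProfile h p := ⟨H, fun y hy => (hbar y hy).1, fun y hy => (hbar y hy).2⟩
  obtain ⟨g, hgh, hgC, hg0, -⟩ := H.exists_contDiffOn_extension
  obtain ⟨W, hW0, hW00, hWC, hWd, C, hC⟩ := B.exists_smooth_defect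
  -- The smooth extension `g` of `h` makes `ρ` an odd smooth function on the whole line.
  set ρ : ℝ → ℝ := fun r => r * g (r ^ 2) with hρ
  have hρh : ∀ r, 0 < r → ρ r = r * h (r ^ 2) := fun r hr => by
    simp only [hρ]
    rw [hgh (pow_pos hr 2)]
  have hρC : ContDiff ℝ ∞ ρ := contDiff_id.mul (contDiffOn_univ.1
    (hgC.comp (contDiff_id.pow 2).contDiffOn fun r _ => mem_Ici.2 (sq_nonneg r)))
  have hev : ∀ r, 0 < r → ρ =ᶠ[𝓝 r] fun r => r * h (r ^ 2) := fun r hr => by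
    filter_upwards [lt_mem_nhds hr] with z hz using hρh z hz
  have hd : ∀ r, 0 < r → deriv ρ r = p (r ^ 2) := fun r hr =>
    ((H.hasDerivAt_radial hr).congr_of_eventuallyEq (hev r hr)).deriv
  have hd2 : ∀ r, 0 < r → deriv (deriv ρ) r
      = (h (r ^ 2) - p (r ^ 2)) / r - r * (1 - r ^ 2 * h (r ^ 2) ^ 2) * h (r ^ 2) := fun r hr =>
    ((H.hasDerivAt_radial_deriv hr).congr_of_eventuallyEq (by
      filter_upwards [lt_mem_nhds hr] with z hz using hd z hz)).deriv
  have hsq : Tendsto (fun r : ℝ => r ^ 2) atTop atTop := tendsto_pow_atTop two_ne_zero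
  have hρ1 : Tendsto ρ atTop (𝓝 1) := by
    refine B.tendsto_radial.congr' ?_
    filter_upwards [eventually_gt_atTop 0] with r hr using (hρh r hr).symm
  have hp0 : Tendsto (fun r => p (r ^ 2)) atTop (𝓝 0) := by
    have h1 : Tendsto (fun r : ℝ => 12 / r ^ 2) atTop (𝓝 0) := tendsto_const_nhds.div_atTop hsq
    refine tendsto_of_tendsto_of_tendsto_of_le_of_le' tendsto_const_nhds h1 ?_ ?_
    · filter_upwards [eventually_gt_atTop 0] with r hr using B.deriv_nonneg (by positivity)
    · filter_upwards [eventually_ge_atTop 1] with r hr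
      rw [le_div_iff₀ (by positivity), mul_comm]
      exact B.mul_deriv_le (one_le_pow₀ hr)
  have hinv : Tendsto (fun r : ℝ => r⁻¹) atTop (𝓝 0) := tendsto_inv_atTop_zero
  have hdefect : Tendsto (fun r => 1 - r ^ 2 * h (r ^ 2) ^ 2) atTop (𝓝 0) := by
    simpa using (B.tendsto_mul_sq.comp hsq).const_sub 1
  refine ⟨ρ, ⟨by exact_mod_cast (contDiff_infty.1 hρC 2).contDiffOn, fun r hr => ?_, hρ1⟩,
    fun σ hσ => ?_, by exact_mod_cast (contDiff_infty.1 hρC 1).contDiffOn, ?_, ?_, fun r hr => ?_,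
    ?_, ?_, ?_, ?_, fun γ _ hγ => ⟨?_, fun x y hxy => by simp only [hxy]⟩⟩
  · rw [hd2 r hr, hd r hr, hρh r hr]
    field_simp
    ring
  · have hl : 0 < g 0 := by
      -- For `y < 1` the lower barrier gives `h² ≥ 1/5 > 1/9`.
      have : (1 / 3 : ℝ) ≤ g 0 := by
        refine ge_of_tendsto hg0 ?_
        filter_upwards [Ioo_mem_nhdsGT one_pos] with y hy
        have h1 := B.le_add_mul_sq hy.1
        have h2 := B.pos hy.1
        by_contra hlt
        push Not at hlt
        nlinarith [hy.2, hy.1]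
      linarith
    have hlim : Tendsto (fun y => σ √y / √y / h y) atTop (𝓝 1) := by
      have h1 : Tendsto (fun r => σ r / (r * h (r ^ 2))) atTop (𝓝 1) := by
        have := hσ.tendsto_one.div B.tendsto_radial one_ne_zero
        rwa [div_one] at this
      refine (h1.comp Real.tendsto_sqrt_atTop).congr' ?_
      filter_upwards [eventually_ge_atTop 0] with y hy
      simp only [Function.comp, Real.sq_sqrt hy, div_div]
    have := H.eqOn_of_tendsto_div hσ.isRadialProfile (fun y hy => B.pos hy)
      (fun y hy => B.deriv_nonneg hy) hl hg0 hlim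
    intro r hr
    have hr : 0 < r := hr
    have h1 := this (pow_pos hr 2)
    simp only [Real.sqrt_sq hr.le] at h1
    rw [hρh r hr, ← h1]
    field_simp
  · refine hp0.congr' ?_
    filter_upwards [eventually_gt_atTop 0] with r hr using (hd r hr).symm
  · have h1 : Tendsto (fun r => (r * h (r ^ 2) * r⁻¹ - p (r ^ 2)) * r⁻¹
        - (1 - r ^ 2 * h (r ^ 2) ^ 2) * (r * h (r ^ 2))) atTop (𝓝 0) := by
      simpa using (((B.tendsto_radial.mul hinv).sub hp0).mul hinv).sub
        (hdefect.mul B.tendsto_radial)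
    refine h1.congr' ?_
    filter_upwards [eventually_gt_atTop 0] with r hr
    rw [hd2 r hr]
    field_simp
  · rw [hρh r hr]
    exact mul_pos hr (B.pos (pow_pos hr 2))
  · exact B.strictMonoOn_radial.congr fun r hr => (hρh r hr).symm
  · refine IsBigO.of_bound 1 ?_
    filter_upwards [self_mem_nhdsWithin] with r hr
    have hr : 0 < r := hr
    have h1 := B.pos (pow_pos hr 2)
    rw [hρh r hr, norm_mul, Real.norm_of_nonneg h1.le, mul_comm]
    exact mul_le_mul_of_nonneg_right (B.le_one (pow_pos hr 2)) (norm_nonneg _)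
  · refine IsBigO.of_bound 4 ?_
    filter_upwards [eventually_gt_atTop 0] with r hr
    have h1 := B.mul_defect_le (pow_pos hr 2)
    have h2 := B.mul_lt_one hr
    have h3 := mul_pos hr (B.pos (pow_pos hr 2))
    rw [hρh r hr, Real.norm_of_nonneg (by linarith), Real.norm_of_nonneg (by positivity),
      mul_one_div, le_div_iff₀ (by positivity)]
    have h4 : 1 - r * h (r ^ 2) ≤ 1 - r ^ 2 * h (r ^ 2) ^ 2 := by nlinarith
    nlinarith [pow_pos hr 2]
  · rw [isLittleO_iff_tendsto' (by
      filter_upwards [eventually_gt_atTop 0] with r hr h0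
      have : 0 < 1 / r ^ 2 := by positivity
      exact absurd h0 this.ne')]
    have h1 : Tendsto (fun r : ℝ => r ^ 2 * (1 - r ^ 2 * h (r ^ 2) ^ 2) - 1) atTop (𝓝 0) := by
      simpa using (B.tendsto_mul_defect.comp hsq).sub_const 1
    refine h1.congr' ?_
    filter_upwards [eventually_gt_atTop 0] with r hr
    rw [hρh r hr]
    field_simp
  · have h1 : (fun x : Plane => ((1 - ρ ‖x‖ ^ 2 : ℝ) : ℂ)) = fun x => ((W 0 (‖x‖ ^ 2) : ℝ) : ℂ) := by
      ext x
      congr 1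
      rcases (norm_nonneg x).eq_or_lt with hx | hx
      · rw [← hx]
        simp [hρ, hW00]
      · rw [hρh _ hx, hW0 _ (pow_pos hx 2), mul_pow]
    rw [h1]
    exact memWeightedSobolev_of_isSymbolFamily hγ
      (IsSymbolFamily.radial (N := 3) (n := 3) (j := 0) hWC hWd hC (by norm_num))
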